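/- Let $n \ge 4$. Let $Q_n$ be the $n$-dimensional hypercube, i.e. the graph on $\{0,1\}^n$ in which two strings are adjacent iff they differ in exactly one bit, and let $K(Q_n)$ be the complete graph on the vertex set $\{0,1\}^n$. For a set $D \subseteq \{1,\dots,n\}$ with $|D| = 4$ and a string $u \in \{0,1\}^{n-4}$, indexed by the coordinates not in $D$, let $Q_D(u)$ be the $4$-dimensional subcube of $Q_n$ induced by all strings whose restriction to the coordinates outside $D$ is $u$; two subcubes $Q_D(u)$ and $Q_D(v)$ are called adjacent if $u$ and $v$ differ in exactly one bit. Let $M$ be a matching in $K(Q_n)$ (a set of pairwise non-adjacent edges, which need not be edges of $Q_n$), and let $m_D(u)$ be the number of vertices of $Q_D(u)$ that are incident with an edge of $M$. Suppose that $m_D(u) \le 7$ for every $u \in \{0,1\}^{n-4}$, that there are at most two $u \in \{0,1\}^{n-4}$ with $m_D(u) \in \{6,7\}$, and that if there are two distinct such strings $u, v$, then the subcubes $Q_D(u)$ and $Q_D(v)$ are adjacent. Then there is a set $S \subseteq E(Q_n)$ such that $M \cup S$ is the edge set of a cycle in $K(Q_n)$ of length at least $\frac34 \cdot 2^n$. 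-/

import Mathlib

/-- The hypercube graph on the bit strings indexed by `ι`: two strings are adjacent iff they
differ in exactly one coordinate. For `ι = Fin n` this is the `n`-dimensional hypercube `Q_n`. -/
def hypercube (ι : Type*) : SimpleGraph (ι → Bool) where
  Adj u v := ∃! i, u i ≠ v i
  symm := ⟨fun _ _ ⟨i, hi, h⟩ => ⟨i, hi.symm, fun j hj => h j hj.symm⟩⟩
  loopless := ⟨fun _ ⟨_, hi, _⟩ => hi rfl⟩

/-- The complete graph `K(Q_n)` on the vertex set of `Q_n`. -/
abbrev cubeComplete (n : ℕ) : SimpleGraph (Fin n → Bool) := ⊤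

/-- Bit strings indexed by the coordinates outside `D`; they name the subcubes `Q_D(u)`. -/
abbrev OuterString {n : ℕ} (D : Finset (Fin n)) : Type := {i : Fin n // i ∉ D} → Bool

/-- The vertex set of the subcube `Q_D(u)`: all strings that agree with `u` outside `D`. -/
def subcube {n : ℕ} (D : Finset (Fin n)) (u : OuterString D) : Set (Fin n → Bool) :=
  {v | ∀ i : {i : Fin n // i ∉ D}, v i = u i}

/-- Two subcubes `Q_D(u)` and `Q_D(v)` are adjacent iff `u` and `v` differ in exactly one bit. -/
def SubcubesAdjacent {n : ℕ} (D : Finset (Fin n)) (u v : OuterString D) : Prop :=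
  (hypercube {i : Fin n // i ∉ D}).Adj u v

/-- The number of vertices of `Q_D(u)` that are incident with an edge of `M`
(for a matching `M`, `M.verts` is the set of vertices incident with its edges). -/
noncomputable def matchedCount {n : ℕ} (M : (cubeComplete n).Subgraph) (D : Finset (Fin n))
    (u : OuterString D) : ℕ :=
  (M.verts ∩ subcube D u).ncard

set_option autoImplicit false

/-! Write the cube as the product of the outer cube, whose vertices index the blocks `Q_D(u)`, and
the four-dimensional cube, whose 16 vertices are the positions in a block. The proof enlarges `M` by
cube edges to a matching with exactly eight ends in every block and then adds, inside each block,
disjoint paths between these ends so that everything closes up to one cycle.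

Enlarging (`exists_extendsMatching_of_isChain`): adjacent vertices of a hypercube are the ends of a
Hamiltonian path, so the outer cube has one whose inner blocks all have at most five ends. Move
along it, adding one or two edges between consecutive blocks, according to parity, and then edges
inside the block just left until it has eight ends. Since the total number of ends is even, the last
block can be completed too. The resulting matching connects all blocks.

Local statement (`hasLinkages_of_ncard_eq_eight`): for eight vertices of the four-dimensional cube
and any perfect pairing of them, some system of paths with these ends covers at least 12 vertices
and forms a single cycle with the pairing. It is checked by computation, up to cube symmetries, from
a table of path systems.

Gluing (`exists_linkage_connected`): fix linkages in all blocks but one. By parity, each component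
of their union with the matching contains an even number of the eight ends in the remaining block,
so these can be paired within components. A linkage suited to that pairing makes the block connected
and does not destroy connectedness of the other blocks. After every block has been treated, the
edges between blocks join everything to one component with all degrees 0 or 2. It has at least 12 of
the 16 vertices of each block, hence the factor 3/4. -/

/-! ### Linkages of the four-dimensional cube, computationally -/

/-- The `v`-th hexadecimal digit of `N`. -/
def hexDigit (N v : ℕ) : ℕ := (N >>> (4 * v)) % 16

/-- `d` has exactly one nonzero bit, which is among the lowest four. -/
def isUnitBit (d : ℕ) : Bool := Nat.beq d 1 || Nat.beq d 2 || Nat.beq d 4 || Nat.beq d 8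

/-- Adjacency in the subgraph of the four-dimensional cube in which the digit of `N` at `x` lists
the directions of the edges at `x`. -/
def codedAdj (N x y : ℕ) : Bool :=
  Nat.ble x 15 && (Nat.ble y 15 && (isUnitBit (x ^^^ y) &&
    (Nat.ble 1 (hexDigit N x &&& (x ^^^ y)) && Nat.ble 1 (hexDigit N y &&& (x ^^^ y)))))

def codedDegree (N x : ℕ) : ℕ :=
  [1, 2, 4, 8].countP fun b => codedAdj N x (x ^^^ b)

/-- Follow the path of the coded graph from `v`, not using direction `b`, up to its end `t`;
returns the set of visited vertices as a bit mask, or `0` on failure. -/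
def trace (N : ℕ) : ℕ → ℕ → ℕ → ℕ → ℕ → ℕ
  | 0, _, _, _, _ => 0
  | k + 1, v, b, t, acc =>
    bif Nat.beq (hexDigit N v) b then
      bif Nat.beq v t then acc ||| 1 <<< v else 0
    else
      bif codedAdj N v (v ^^^ (hexDigit N v - b)) then
        trace N k (v ^^^ (hexDigit N v - b)) (hexDigit N v - b) t (acc ||| 1 <<< v)
      else 0

def maskMem (m x : ℕ) : Bool := Nat.beq ((m >>> x) % 2) 1

def maskList (m : ℕ) : List ℕ := (List.range 16).filter (maskMem m)

/-- At an end no direction has been used yet, hence the initial direction 0. A path has at most 16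
vertices, so 16 rounds suffice. -/
def pathMask (N τ a : ℕ) : ℕ := trace N 16 a 0 (hexDigit τ a) 0

/-- `N` codes a linkage with set of ends `m` and end pairing `τ` that has at least 12 vertices. -/
def isLinkage (m N τ : ℕ) : Bool :=
  ((List.range 16).all fun x =>
    bif maskMem m x then
      Nat.beq (codedDegree N x) 1 && (maskMem m (hexDigit τ x) && Nat.ble 1 (pathMask N τ x))
    else Nat.beq (codedDegree N x) 0 || (Nat.beq (codedDegree N x) 2 &&
      (maskList m).any fun a => maskMem (pathMask N τ a) x)) &&
  Nat.ble 12 ((List.range 16).countP fun x => Nat.ble 1 (codedDegree N x))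

/-- Starting at `v`, alternate between the pairings `τ` and `ν` and check that the vertices met
are exactly those of `m`. -/
def isSingleCycle (τ : ℕ) (ν : ℕ → ℕ) (m : ℕ) : ℕ → ℕ → ℕ → Bool
  | 0, _, acc => Nat.beq acc m
  | k + 1, v, acc =>
    isSingleCycle τ ν m k (ν (hexDigit τ v)) (acc ||| (1 <<< v ||| 1 <<< hexDigit τ v))

/-- `f` holds for all extensions of `ν` by a perfect pairing of the list. -/
def forallPairings (f : (ℕ → ℕ) → Bool) : ℕ → List ℕ → (ℕ → ℕ) → Bool
  | _, [], ν => f ν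
  | 0, _ :: _, _ => false
  | k + 1, x :: t, ν => t.all fun y => forallPairings f k (t.erase y)
      fun a => bif Nat.beq a x then y else bif Nat.beq a y then x else ν a

/-- For eight ends, four pairs have to be chosen, and a single cycle through them uses each of `τ`
and `ν` four times; both counters are therefore 4. The initial pairing is constantly 0 because every
end is still unpaired. -/
def isLinkageFamily (r : ℕ × List (ℕ × ℕ)) : Bool :=
  r.2.all (fun c => isLinkage r.1 c.1 c.2) &&
  match maskList r.1 with
  | [] => false
  | x :: t => forallPairings (fun ν => r.2.any fun c => isSingleCycle c.2 ν r.1 4 x 0) 4 (x :: t)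
      fun _ => 0

/-- Each entry is the bit mask of an 8-set followed by a few pairs `(N, τ)`: the directions at each
vertex and the induced pairing of the ends. The linkages of an entry together serve all 105 perfect
pairings of its 8-set. -/
def linkageTable : List (ℕ × List (ℕ × ℕ)) := [
  (255, [(0x6c39c69328288282, 0x51734062), (0xa930a9348844884, 0x35607124),
    (0x93ca005984882428, 0x42071635), (0xaa33000088111111, 0x67452301),
    (0x9500ac3982428848, 0x24160753)]),
  (383, [(0x393151444844, 0x203106854), (0x353935a864284488, 0x2315648),
    (0x93530051a2222222, 0x504861032), (0x3539ac3131288811, 0x305628401),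
    (0x59396831282828, 0x5621438), (0x9353005191441144, 0x608102354)]),
  (447, [(0xc0035a84c114488, 0x30457128), (0x9393009180841184, 0x150702384),
    (0x6ca955115888411, 0x520834701), (0x990093028a428242, 0x340178052),
    (0x5393530215842424, 0x520801734), (0x9393930286828411, 0x350728401)]),
  (495, [(0x393122262824, 0x250701836), (0x35393531114c1144, 0x67102358),
    (0x393539a448154884, 0x638007125), (0x9500ac3182138811, 0x325608701),
    (0xac6c95c488198282, 0x513806072)]),
  (510, [(0xac6396448844815, 0x638217540), (0x9500ac3182428840, 0x324168750),
    (0xc00959128248286, 0x153726480), (0x9353005184112420, 0x782451630),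
    (0x35ac950411888213, 0x467385120)]),
  (831, [(0x93c6004493821111, 0x5400982301), (0x93930088c6824488, 0x1000325498),
    (0x332235242424, 0x8900201534), (0x5959534259484242, 0x4300198052),
    (0x9306a02495118411, 0x3200459801), (0x393500846c244484, 0x1200305894)]),
  (863, [(0x9306a024a4648444, 0x3102009684), (0x392851514848, 0x2003016948),
    (0xaa660044a8312222, 0x4608091032), (0x93539342a2628242, 0x1304068092),
    (0x53c6594451914811, 0x4203096801), (0x332231641144, 0x8901002364)]),
  (879, [(0x95590642a42c2424, 0x502801639), (0x950c3524c24a4242, 0x3608109052),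
    (0x53c6594451804811, 0x5203906801), (0x35390682312c1184, 0x1005602398),
    (0x6c396622084c1144, 0x608102359), (0x93060084c2134282, 0x1305608092)]),
  (893, [(0x6c39662208481151, 0x4608092305), (0x530a5988514848c8, 0x5003926408),
    (0x3539951131288202, 0x8905634002), (0x93060084a42424a4, 0x3502809604),
    (0x5306598462224891, 0x204365809)]),
  (894, [(0x93ca0048c4884419, 0x5102934680), (0xac353524a8242226, 0x6509821430),
    (0x353935285148424a, 0x4203196850), (0x332262224213, 0x8904365120),
    (0x9306008491111180, 0x1608452390)]),
  (975, [(0x3935392428352824, 0x2608001937), (0x599342246c8444, 0x312008679),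
    (0xa930a8248954884, 0x1230007896), (0x3539a62211598242, 0x3167009082),
    (0x93c6004482931111, 0x6789002301)]),
  (983, [(0x6aa6602448c45144, 0x1628000794), (0xc0095112831a222, 0x8941070062),
    (0xca93602888913128, 0x7094060128), (0x693a62222a29111, 0x2784060901),
    (0x5393602844916428, 0x4012090678), (0x5995602428a43124, 0x6789000124)]),
  (987, [(0x693a62211c48044, 0x3167009084), (0x95392422a22a22, 0x784061039),
    (0x3539951124688642, 0x8910034076), (0x5900ca8228318a82, 0x1043076098),
    (0xaa66004488511342, 0x7698010043)]),
  (989, [(0x6aa6598428a428a4, 0x3628009704), (0x3539951124688451, 0x8902034607),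
    (0x3960004828311108, 0x6049072308), (0x95392411912831, 0x2467080903),
    (0xc693662282c22262, 0x7394068002)]),
  (990, [(0x3539ac2811088819, 0x3167029480), (0x5393602844c4444c, 0x1432087690),
    (0x5353534222621140, 0x8914062370), (0x3935392428312820, 0x2648071930),
    (0x59c0ca4228a48815, 0x7293016840)]),
  (1020, [(0x356c954411488253, 0x3467289500), (0x5353534244114400, 0x8932457600),
    (0xcac6594488842835, 0x5628934700), (0xc5995482828820a, 0x4253796800),
    (0x9306392482422860, 0x2784365900)]),
  (1647, [(0x93060286c4154484, 0x3100200a695), (0x60396820514c4844, 0x20003106a59),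
    (0xa66a044091192222, 0x56009a01032), (0x6c39642008191111, 0x6500a902301),
    (0x3539a420044c8444, 0x300210965a), (0x93530840c2134811, 0x23005609a01)]),
  (1655, [(0xca535140c8116222, 0x160094500a2), (0x6035c88c6222c888, 0x21004060a95),
    (0xac350415a8243124, 0x6500a900124), (0x6039622a64286428, 0x400219065a),
    (0x530ac21331289111, 0x9a005620401)]),
  (1659, [(0x6039682051484a42, 0x400319605a), (0x93060286c4114682, 0x3100045a096),
    (0xca535140a8242024, 0x56009a01034), (0xa035312ca2222028, 0x9a004061035),
    (0x93530840c4114c11, 0x6300a459001), (0x99000880a8241984, 0x3100560a094)]),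
  (1662, [(0xca936820c8844815, 0x23005619a40), (0x9353024a91111119, 0x160094523a0),
    (0x5393518051844286, 0x51003a26490), (0x9353024aa424242c, 0x450029a1630),
    (0x95000419c242424a, 0x3200416a950)]),
  (1695, [(0x95911515c48444, 0x3102000a794), (0x3960024a2a621148, 0x401009237a),
    (0x5393511926a22428, 0x700a0021439), (0x3535041540514242, 0x9a030017042),
    (0x3935a2262c318411, 0x23040079a01)]),
  (1719, [(0x9595a42c8682a428, 0x710a0020495), (0xa22a13429148, 0x204017095a),
    (0x91191511a428, 0x100204507a9), (0x393591152a229111, 0x24050790a01),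
    (0x39a002134c846424, 0x9a010200574)]),
  (1723, [(0x66aac48015888682, 0x410003a5097), (0x595951402c281511, 0x3405079a001),
    (0x9500041986421548, 0x700a0134059), (0x95312c13822028, 0x9a040071035),
    (0x35ac041515881511, 0x54030a97001), (0x5393518013821382, 0x51040a70093)]),
  (1725, [(0x393591152a228202, 0x3405079a002), (0xca9351808c8424a4, 0x730a0209504),
    (0x5393518013821191, 0x50040a72309), (0x396c02464c484451, 0x420300a7905),
    (0x530ac28a154884c8, 0x502093470a)]),
  (1779, [(0x39ac081548886a22, 0x401569007a), (0x693a4204282c011, 0x57094a60001),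
    (0x93ca91408488a622, 0x150409700a6), (0x6c39c48028289382, 0x6105a700094),
    (0x3539a42011489342, 0x400671a0059)]),
  (1782, [(0x66aac41911889119, 0x410672a0590), (0x393591154811c213, 0x760a9450120),
    (0x5900c2132824a226, 0x9a051720460), (0x590051194844514c, 0x6402a190750),
    (0x53c6c84c4282c819, 0x25014960a70)]),
  (1785, [(0x93ca084084882c31, 0x6504a970003), (0x6039682011481951, 0x3406709a005),
    (0x9393088082822aa2, 0x305476900a), (0xa66a044084482662, 0x470903a5006),
    (0xa035312c84111508, 0x9a003456007)]),
  (1910, [(0xcac65144c8846226, 0x156089204a0), (0xa2225111c213, 0x86a09450120),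
    (0x5991486428c419, 0x54102a90680), (0x6035682462226820, 0x28904160a50),
    (0x590051886824518c, 0x6140a280590)]),
  (1913, [(0xca065184a82420a4, 0x53608a09004), (0xc088451484ac2, 0x540398600a),
    (0x6039682804482c68, 0x6400a395008), (0x6035682402421951, 0x3890406a005),
    (0x530ac28231288091, 0x80a05634009)]),
  (1914, [(0x6039622231281313, 0x84a05691030), (0x95000488a222138a, 0x51304a68090),
    (0x3539041164284613, 0x489013a5060), (0x93530848c4444c4c, 0x6340a189050),
    (0xaa660844a8241915, 0x3560891a040)]),
  (1971, [(0xcc91441588a622, 0x154009800a7), (0xac35a4248a429342, 0x407801a0059),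
    (0x95312413820011, 0x9a540870001), (0x6c35c48419119382, 0x710a0450098),
    (0x5393511146826622, 0x58910a00074)]),
  (1973, [(0x59cc51444c886431, 0x25400980a07), (0x59955184198431a4, 0x725a0800904),
    (0xac6004488a423168, 0x470902a0508), (0xa2221511a431, 0x80a20450709),
    (0x91112622a431, 0x895072040a)]),
  (1974, [(0x59c051484c84642c, 0x25410980a70), (0x95312440845115, 0x9a520810740),
    (0xc00a4282a229119, 0x421507a0980), (0x6ca0c4111984a226, 0x789a0120450),
    (0x693a4281382a22a, 0x51240a70890)]),
  (1980, [(0xca9362228c842435, 0x87a90234500), (0x312813421159, 0x9a540872300),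
    (0x55914420248206, 0x3895072a400), (0x59005188191122aa, 0x732a0459800),
    (0x6aa6c88419848895, 0x24780395a00)]),
  (2019, [(0x60396222424a5342, 0x86a09100057), (0x60ac6824428a6a22, 0x561890007a),
    (0xa66a044884193528, 0x57091a00068), (0x950ca4248419a622, 0x715a0800096),
    (0x6039c8114419cc11, 0x6895a700001)]),
  (2022, [(0x6039622211190213, 0x85a67900120), (0x396c9144484cc246, 0x762a9100850),
    (0x39ac3124488c5115, 0x9a125600780), (0x5900511148156226, 0x6891a200570),
    (0x95a8244286c815, 0x27591800a60)]),
  (2025, [(0xc0884444c4cc4, 0x6503a907008), (0x3535a42411408051, 0x83a67009005),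
    (0x9500041182132031, 0x789a5600003), (0xc0884222a1991, 0x3065870a009),
    (0x9306312484402662, 0x9a780305006)]),
  (2033, [(0x3539a4281148a068, 0x450679a0008), (0x95950484848435a4, 0x765a9800004),
    (0xca8242428ac31, 0x6045a780009), (0x9353024284113531, 0x87a90450006),
    (0x9306312482420051, 0x9a784060005)]),
  (2034, [(0x66aac41111889313, 0x489671a0050), (0x3960024248115313, 0x86a19450070),
    (0xc0ca42428289313, 0x6145a780090), (0x693a4284282c019, 0x57194a60080),
    (0x6aa6682448845915, 0x756a8910040)]),
  (2040, [(0xa039911184488653, 0x3894567a000), (0x3935088428242aa6, 0x436587a9000),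
    (0xac6004488811130a, 0x6739a458000), (0x9595048484841595, 0x745a3896000),
    (0x35350484424240c0, 0x85a34967000)]),
  (4080, [(0x55004488114400cc, 0xab5467980000), (0x828224249595, 0x684a5b790000),
    (0x9500841182429353, 0x5789a4b60000), (0xc653444884113539, 0x79a6b8450000),
    (0x95282444846c35, 0x96b54a870000)]),
  (5739, [(0x9504041591401342, 0x906c00a100053), (0x95080480c4194682, 0x5031000c0a096),
    (0xa064024691152024, 0xa0c6009001035), (0x93020880c2134a82, 0x300100560c09a),
    (0x93c20840c4804c11, 0x306500a90c001), (0x3964024668204011, 0xa0c6009305001)]),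
  (5742, [(0xac310419c840424a, 0x306200a10c950), (0xa068024aa22a1119, 0x601500c9023a0),
    (0x8081951194819, 0x5021003c06a90), (0xa0640246c2134213, 0xa0c3005609120),
    (0x80213642c4415, 0x109a0023056c0)]),
  (5775, [(0x590451152a661144, 0x900c01000237a), (0x599151804c954484, 0x21030007a9c),
    (0xcac251408c952424, 0x20700a0001c39), (0x5302c21315008411, 0x309a02000c701),
    (0xaa6291408a538242, 0x103709000a0c2)]),
  (5783, [(0x491151504a424, 0x901c0200007a4), (0x6c31c41919519148, 0x20700a0010c49),
    (0x6aa2622a19913128, 0x70040c009012a), (0x4312c46026428, 0x9a01002047c),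
    (0x4a2262031a222, 0xa0c1040070092)]),
  (5787, [(0x91021346c24642, 0x109a0300070c4), (0x393191802c318682, 0x3104007a09c),
    (0x4a22615518642, 0xa0c3000019047), (0x59c851402ca82622, 0x40070900c103a),
    (0x5302c81926628c48, 0x30400100ac079)]),
  (5790, [(0x53c2c24a15918419, 0x301402009c7a0), (0x393191192a62824a, 0x40320100ca970),
    (0x4312c2031222a, 0x209a040071c30), (0x35a4a42c26a28419, 0x10730a00294c0),
    (0x6aa2511919911119, 0x70410c00a2390)]),
  (5803, [(0x396402464c404642, 0xa0c0030107059), (0x590451152c202622, 0x900c05070103a),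
    (0x95c80440868a1511, 0x30750a090c001), (0x4a22615408642, 0xa0c3000109057),
    (0x35a80480468a4682, 0x51030a0709c), (0xac6804408c192622, 0x5007090c0103a)]),
  (5805, [(0x4911513138202, 0x903c05070a002), (0x8021315192431, 0x509a020c00703),
    (0xac64044c8a131108, 0x57090a0230c), (0x8028a464a44c8, 0x2005030907c0a),
    (0x60a8c880138a8891, 0x70200c0305a09)]),
  (5806, [(0xa064914c86138419, 0x103709020a5c0), (0x5302c21315158415, 0x309a02010c750),
    (0x3968024a4c194419, 0x5012030c079a0), (0x6ca8c480198c8286, 0x20710a0305c90),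
    (0x35a4041513861115, 0x905c010a02370)]),
  (5820, [(0xac3104198a421159, 0x70450c09a2300), (0x5302622a15112439, 0x903c02045a700),
    (0x6aa251804a824293, 0x4052030ac7900), (0x4312c1342226a, 0x209a040375c00),
    (0xcc9164208c842435, 0x5027090c34a00)]),
  (5865, [(0x3968084048194a02, 0x5006039c0700a), (0x9504048c821320a8, 0x730a560900c),
    (0x5302518024201591, 0xa0c0053706009), (0x93029180844086c2, 0x70350c090a006),
    (0x35a4041511802031, 0x905c067a00003)]),
  (5866, [(0xa064084c82131919, 0x103709560a0c0), (0x9302081984152c2c, 0x70650ca901030),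
    (0x5302511924201519, 0xa0c1053706090), (0x8a82011198a13, 0x5013067c090a0),
    (0x3931021348154015, 0x609a03c107050)]),
  (6023, [(0x6aa2622219953124, 0x7080ac0000129), (0x91312846936428, 0x209a010000c78),
    (0xc491441393a222, 0x8017c900000a2), (0x5302511120353124, 0xa0c8900000127),
    (0x599151114ac65144, 0x10089200007ca), (0x53c2c2421393a222, 0x1087a900000c2)]),
  (6027, [(0xac3104118a531342, 0x70189c00000a3), (0x8a22215598642, 0x1083a000090c7),
    (0x95c4044486932622, 0x8070ca0001039), (0x66a2642815c01548, 0xa0c1030007098),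
    (0x60a8622213ca1342, 0x7081ac0000093), (0x396491442c608642, 0x8030c1000a079)]),
  (6030, [(0x35a4a42415958415, 0x8013c200097a0), (0x53c2c24213938213, 0x3087a9000c120),
    (0x91312813931119, 0x709a1c0002380), (0x599151114c954415, 0x1028930007ac0),
    (0x393191882c35848c, 0x203178000ac90)]),
  (6038, [(0x6aa262224c916420, 0x2084a10090c70), (0xac291482aa2a22a, 0x40172900c08a0),
    (0x3531a42820319119, 0xa0c2140070980), (0x35a4a4241591a420, 0x8041c200a0790),
    (0x6c31c4111904a226, 0x10789a00204c0)]),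
  (6041, [(0x93c2024286c21551, 0x7080ac0034009), (0x91312815911508, 0x409a0300c7008),
    (0xac6404448c511551, 0x8037c9000a004), (0x5302511126621551, 0xa0c8900034007),
    (0x6c31c4112c318602, 0x300894007c00a), (0xaa6202428c511551, 0x3087a9000c004)]),
  (6042, [(0xc4914415918613, 0x8034c1009a070), (0x35a8a42815c8864a, 0x40137800c90a0),
    (0x595151481951134a, 0x907c3a0018040), (0x91312815c4154c, 0x109a4300870c0),
    (0x53c2c24213c28040, 0x3081a4007c090)]),
  (6057, [(0xac6804488c191508, 0x5037090c0a008), (0x4a82415408c51, 0x8073ca0009005),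
    (0x5302c282154086c2, 0x3085a0090c007), (0xac3104118c402662, 0x70089c030500a),
    (0xac6404448c401551, 0x8037c9000a005), (0x5302511113132031, 0xa0c8950700003)]),
  (6060, [(0x393131281915110c, 0x709a5c0802300), (0xc04a42419408253, 0x8073ca0209500),
    (0x5302c28213138293, 0x3082a5070c900), (0x530268281346286c, 0x902c780305a00),
    (0x6aa251114a864206, 0x2058930a07c00)]),
  (6120, [(0x955104488213130a, 0x907c3a5608000), (0xa0680242824a1353, 0x6087a9c305000),
    (0x4088422261995, 0x8036c5970a000), (0x831284419460a, 0x509a638c07000),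
    (0x35a80411118c1306, 0x3058967a0c000)]),
  (6375, [(0x99088000884c9144, 0x200067100b5c), (0x39648ac64815c884, 0x27000b1000c65),
    (0x5904409528200282, 0x160005b7000c2), (0xa06880598419a428, 0x5100002c006b7),
    (0x51135342135111, 0xbc00025600701)]),
  (6627, [(0x82031424a5342, 0x6800b0c100057), (0x95c81551848c3524, 0x7005b180006c),
    (0x512a6211153924, 0xbc00167000085), (0x93028a028213aa22, 0x71000c56000b8),
    (0xac6886c288199382, 0x5000618c0007b)]),
  (6630, [(0x35a4150442865115, 0x8500c21b00760), (0x990880088819a22a, 0x5100267c008b0),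
    (0x59084091282c0286, 0x260015b700c80), (0x35a88602448cc415, 0x17005b28006c0),
    (0xc51266248156226, 0xbc00618200570)]),
  (6633, [(0xa0682a62844c2c64, 0x7006b830500c), (0x51195111401951, 0x8300c6700b005),
    (0x930220a8844015c8, 0x75000c3b06008), (0x9551266282132031, 0xbc00785600003),
    (0x35a826a2428a4091, 0x600053c80700b)]),
  (6634, [(0x51195144154c15, 0x8600c3b107050), (0x512a6222261915, 0xbc00351708060),
    (0x930220a88415158c, 0x71005c38060b0), (0xa6628c5182138a13, 0x130078560b0c0),
    (0x66a24c0811801919, 0x3500167b0c080)]),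
  (6641, [(0x39682a6228283931, 0x460005b7c0008), (0x512a6244116c31, 0xbc00608450007),
    (0x93c2195182823931, 0x70005c486000b), (0x35a82c3111883931, 0x4800b670c0005),
    (0x518ac24444ccc4, 0x57006b8c00004), (0x955186c2844495c4, 0x560078bc00004)]),
  (6642, [(0x5180c84411c68a, 0x17006b84500c0), (0x95c8266284880613, 0x4500781bc0060),
    (0x91203142825313, 0x5800b14c60070), (0x512a6211440a46, 0xbc00467180050),
    (0x39a420a448845386, 0x8100c456700b0)]),
  (6648, [(0x5113c211111393, 0x3800b6745c000), (0x9551266282421353, 0xbc00784365000),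
    (0x35a42ca444844c95, 0x8400c356b7000), (0x9591159184841595, 0x57004b3c86000),
    (0x5908409128281393, 0x460035b7c8000)]),
  (7128, [(0x93021382845115c0, 0x7804bc3096000), (0x53c24a4211c42a66, 0xbc03467089000),
    (0x5908401128681353, 0x460893b0c7000), (0x393120282831130a, 0x690b34c078000),
    (0x51194822621959, 0x930c78406b000)]),
  (7140, [(0xac68864288199100, 0x5207698c00b00), (0x93021382821331a0, 0x7802bc5600900),
    (0x35a4158442865195, 0x8506c29b00700), (0x35a82622118c3135, 0x290b567800c00),
    (0x5951404828203139, 0x960c25b700800)]),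
  (7905, [(0x93c2114084803531, 0x7ab50c0900006), (0x488154440cc51, 0x976c0ba000005),
    (0xa06482468213a031, 0xa0c709560000b), (0x5908421348196031, 0x569a00bc00007),
    (0x82820114c3964, 0x95b067a0000c)]),
  (7912, [(0xc008428a824a13ca, 0x67350bc90a000), (0xac31242088401353, 0x796b0ca305000),
    (0xa064824682138000, 0xa3c709560b000), (0x8118011191393, 0x5ab3067c09000),
    (0x59084213282c1306, 0x369a05b70c000)]),
  (15555, [(0x5984420648c05342, 0x1a6c000b0000d7), (0x39288293480cc084, 0x607100bd0000ac),
    (0x951184008400a622, 0xcd1700a00000b6), (0xa024283582530a42, 0x7bc000d100006a),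
    (0x84119511950084, 0x1ab00670000cd)]),
  (27030, [(0x21380081504a42c, 0xde01004200807b0), (0x84080514c04c415, 0x280700db0010e40),
    (0x88020312aa20213, 0x470800bd00e0120), (0x480860213c29140, 0x810200e40070bd0),
    (0x9140206886020419, 0x7b0d001e0020480)])]


theorem linkageTable_all : linkageTable.all isLinkageFamily = true := by decide +kernel

/-! ### Reduction of all 8-subsets to the table -/

/-- Image of the vertex set `m` under the involution that exchanges the vertices `x` in `a` with
`x + s` and fixes the vertices in `b`. -/
def swapMask (g : ℕ × ℕ × ℕ) (m : ℕ) : ℕ :=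
  ((m &&& g.2.1) <<< g.1) ||| (((m >>> g.1) &&& g.2.1) ||| (m &&& g.2.2))

/-- The four coordinate flips and the six coordinate transpositions. -/
def cubeSymmetries : List (ℕ × ℕ × ℕ) :=
  [(1, 0x5555, 0x0), (2, 0x3333, 0x0), (4, 0xf0f, 0x0), (8, 0xff, 0x0),
    -- Exchanging bits `i < j` adds `2^j - 2^i` to the vertices with bit `i` set and bit `j` clear,
    -- and fixes those where the two bits agree.
    (1, 0x2222, 0x9999), (3, 0xa0a, 0xa5a5), (7, 0xaa, 0xaa55),
    (2, 0xc0c, 0xc3c3), (6, 0xcc, 0xcc33), (4, 0xf0, 0xf00f)]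

/-- Asks whether `k` successive symmetries take `m'` to a mask numerically below `m`. This is the
descent step of a strong induction on masks, so no canonical forms of orbits are needed. -/
def isLowered : ℕ → ℕ → ℕ → Bool
  | 0, m, m' => Nat.blt m' m
  | k + 1, m, m' => cubeSymmetries.any fun g => isLowered k m (swapMask g m')

/-- The cheap tests come before the searches over two and three symmetries. -/
def isCovered (m : ℕ) : Bool :=
  isLowered 1 m m || (linkageTable.any (fun r => Nat.beq r.1 m) ||
    (isLowered 2 m m || isLowered 3 m m))

/-- `f` holds for all numbers that arise from `m` by adding `k` distinct powers `2 ^ i`, `i < n`. -/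
def forallSubsets (f : ℕ → Bool) : ℕ → ℕ → ℕ → Bool
  | 0, 0, m => f m
  | 0, _ + 1, _ => true
  | _ + 1, 0, m => f m
  | n + 1, k + 1, m => forallSubsets f n (k + 1) m && forallSubsets f n k (m + 2 ^ n)

theorem forallSubsets_isCovered : forallSubsets isCovered 16 8 0 = true := by decide +kernel

/-! ### Soundness of the computation -/

/-- The four-dimensional cube on `Fin 16`. -/
def fourCube : SimpleGraph (Fin 16) where
  Adj x y := isUnitBit (x.val ^^^ y.val) = true
  symm := ⟨fun x y h => by rwa [Nat.xor_comm]⟩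
  loopless := ⟨fun x h => by simp [isUnitBit] at h⟩

/-- `S` is a linkage with set of ends `A` in the four-dimensional cube: a disjoint union of paths
with ends in `A` and of cycles. -/
structure IsLinkage (A : Set (Fin 16)) (S : SimpleGraph (Fin 16)) : Prop where
  le : S ≤ fourCube
  ends : ∀ x ∈ A, (S.neighborSet x).ncard = 1
  inner : ∀ x ∉ A, (S.neighborSet x).ncard = 0 ∨ (S.neighborSet x).ncard = 2
  large : 12 ≤ S.support.ncard

/-- Every perfect pairing `p` of `A` can be joined by a linkage to a single cycle. -/
def HasLinkages (A : Set (Fin 16)) : Prop :=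
  ∀ p : Fin 16 → Fin 16, (∀ x ∈ A, p x ∈ A ∧ p x ≠ x ∧ p (p x) = x) →
    ∃ S, IsLinkage A S ∧ ∀ x ∈ S.support, ∀ y ∈ S.support,
      Relation.EqvGen (fun a b => S.Adj a b ∨ a ∈ A ∧ b = p a) x y

def codedGraph (N : ℕ) : SimpleGraph (Fin 16) where
  Adj x y := codedAdj N x y = true
  symm := ⟨fun x y h => by
    simp only [codedAdj, Bool.and_eq_true] at h ⊢
    rw [Nat.xor_comm y.val x.val]; tauto⟩
  loopless := ⟨fun x h => by simp [codedAdj, isUnitBit] at h⟩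

theorem codedAdj_lt {N x y : ℕ} (h : codedAdj N x y = true) : x < 16 ∧ y < 16 := by
  simp only [codedAdj, Bool.and_eq_true, Nat.ble_eq] at h
  omega

theorem codedGraph_le (N : ℕ) : codedGraph N ≤ fourCube := by
  intro x y h
  simp only [codedGraph, codedAdj, Bool.and_eq_true] at h
  exact h.2.2.1

theorem ncard_neighborSet_codedGraph (N : ℕ) (x : Fin 16) :
    ((codedGraph N).neighborSet x).ncard = codedDegree N x := by
  have hd : ([1, 2, 4, 8].filter fun b => codedAdj N x (x ^^^ b)).Nodup :=
    List.Nodup.filter _ (by decide)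
  rw [codedDegree, List.countP_eq_length_filter, ← List.toFinset_card_of_nodup hd,
    ← Set.ncard_coe_finset]
  refine Set.ncard_congr (fun y _ => x.val ^^^ y.val) ?_ ?_ ?_
  · intro y hy
    have hy' : codedAdj N x y = true := hy
    have h2 := codedGraph_le N hy
    simp only [fourCube, isUnitBit, Bool.or_eq_true, Nat.beq_eq] at h2
    simp only [List.coe_toFinset, List.mem_filter, List.mem_cons, List.not_mem_nil, or_false,
      Set.mem_ofPred_eq, Nat.xor_xor_cancel_left, hy', and_true]
    tauto
  · intro y z _ _ h
    exact Fin.ext (Nat.xor_right_injective h)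
  · intro b hb
    simp only [List.coe_toFinset, List.mem_filter, Set.mem_ofPred_eq] at hb
    exact ⟨⟨x.val ^^^ b, (codedAdj_lt hb.2).2⟩, hb.2, by simp⟩

theorem mem_support_iff_ncard {V : Type*} [Finite V] (S : SimpleGraph V) (x : V) :
    x ∈ S.support ↔ 1 ≤ (S.neighborSet x).ncard := by
  change _ ↔ 0 < _
  rw [Set.ncard_pos]
  rfl

theorem maskMem_eq_testBit (m x : ℕ) : maskMem m x = m.testBit x := by
  rw [maskMem, Nat.testBit_eq_decide_div_mod_eq, Nat.shiftRight_eq_div_pow, Bool.eq_iff_iff]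
  simp

theorem testBit_one_shiftLeft (v x : ℕ) : (1 <<< v).testBit x = decide (v = x) := by
  rw [Nat.one_shiftLeft, Nat.testBit_two_pow]

/-- Only reachability is extracted. That the trace is a path without repetitions plays no role,
since degrees are checked separately. -/
theorem trace_sound (N : ℕ) : ∀ (k v b t acc : ℕ) (hv : v < 16), trace N k v b t acc ≠ 0 →
    (∃ ht : t < 16, (codedGraph N).Reachable ⟨v, hv⟩ ⟨t, ht⟩) ∧
    ∀ (x : ℕ) (hx : x < 16), (trace N k v b t acc).testBit x = true →
      acc.testBit x = true ∨ (codedGraph N).Reachable ⟨v, hv⟩ ⟨x, hx⟩ := by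
  intro k
  induction k with
  | zero => intro v b t acc hv h; simp [trace] at h
  | succ k ih =>
    intro v b t acc hv h
    rw [trace] at h ⊢
    by_cases h1 : Nat.beq (hexDigit N v) b = true
    · by_cases h2 : Nat.beq v t = true
      · simp only [h1, h2, cond_true] at h ⊢
        obtain rfl : v = t := Nat.eq_of_beq_eq_true h2
        refine ⟨⟨hv, .rfl⟩, fun x hx hb => ?_⟩
        rw [Nat.testBit_lor, testBit_one_shiftLeft, Bool.or_eq_true, decide_eq_true_eq] at hb
        rcases hb with hb | rfl
        · exact Or.inl hb
        · exact Or.inr .rfl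
      · simp [h1, h2] at h
    · by_cases h2 : codedAdj N v (v ^^^ (hexDigit N v - b)) = true
      · simp only [h1, h2, cond_true, cond_false] at h ⊢
        have hw := (codedAdj_lt h2).2
        have hr : (codedGraph N).Reachable ⟨v, hv⟩ ⟨_, hw⟩ :=
          SimpleGraph.Adj.reachable (G := codedGraph N) h2
        obtain ⟨⟨ht, h3⟩, h4⟩ := ih _ _ _ _ hw h
        refine ⟨⟨ht, hr.trans h3⟩, fun x hx hb => ?_⟩
        rcases h4 x hx hb with hb | hb
        · rw [Nat.testBit_lor, testBit_one_shiftLeft, Bool.or_eq_true, decide_eq_true_eq] at hb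
          rcases hb with hb | rfl
          · exact Or.inl hb
          · exact Or.inr .rfl
        · exact Or.inr (hr.trans hb)
      · simp [h1, h2] at h

/-- The set of vertices coded by a bit mask. -/
def maskSet (m : ℕ) : Set (Fin 16) := {x | m.testBit x = true}

theorem isLinkage_sound {m N τ : ℕ} (h : isLinkage m N τ = true) :
    IsLinkage (maskSet m) (codedGraph N) ∧
    (∀ x ∈ maskSet m, ∃ y ∈ maskSet m, y.val = hexDigit τ x ∧ (codedGraph N).Reachable x y) ∧
    ∀ x ∈ (codedGraph N).support, ∃ a ∈ maskSet m, (codedGraph N).Reachable a x := by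
  simp only [isLinkage, Bool.and_eq_true, Nat.ble_eq, List.all_eq_true, List.mem_range] at h
  obtain ⟨h1, h2⟩ := h
  have hin : ∀ x ∈ maskSet m, (codedDegree N x = 1 ∧ m.testBit (hexDigit τ x) = true ∧
      1 ≤ pathMask N τ x) := by
    intro x hx
    have h3 := h1 x x.isLt
    rw [maskMem_eq_testBit, show m.testBit x = true from hx, cond_true] at h3
    simpa only [Bool.and_eq_true, Nat.ble_eq, Nat.beq_eq, maskMem_eq_testBit] using h3
  have hout : ∀ x ∉ maskSet m, (codedDegree N x = 0 ∨ codedDegree N x = 2 ∧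
      ∃ a ∈ maskList m, (pathMask N τ a).testBit x = true) := by
    intro x hx
    have h3 := h1 x x.isLt
    rw [maskMem_eq_testBit, show m.testBit x = false by simpa [maskSet] using hx, cond_false] at h3
    simpa only [Bool.and_eq_true, Bool.or_eq_true, Nat.beq_eq, List.any_eq_true,
      maskMem_eq_testBit] using h3
  have hpath : ∀ x ∈ maskSet m, ∃ y ∈ maskSet m, y.val = hexDigit τ x ∧
      (codedGraph N).Reachable x y := by
    intro x hx
    obtain ⟨-, h4, h5⟩ := hin x hx
    obtain ⟨⟨ht, h6⟩, -⟩ := trace_sound N 16 x 0 (hexDigit τ x) 0 x.isLt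
      (Nat.one_le_iff_ne_zero.1 h5)
    exact ⟨⟨_, ht⟩, h4, rfl, h6⟩
  refine ⟨⟨codedGraph_le N, fun x hx => ?_, fun x hx => ?_, ?_⟩, hpath, fun x hx => ?_⟩
  · rw [ncard_neighborSet_codedGraph, (hin x hx).1]
  · rw [ncard_neighborSet_codedGraph]
    rcases hout x hx with h3 | h3
    · exact Or.inl h3
    · exact Or.inr h3.1
  · refine h2.trans ?_
    rw [List.countP_eq_length_filter, ← List.toFinset_card_of_nodup
      (List.Nodup.filter _ List.nodup_range), ← Set.ncard_coe_finset]
    rw [← Set.ncard_image_of_injective _ Fin.val_injective]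
    refine Set.ncard_le_ncard ?_ (Set.toFinite _)
    intro x hx
    simp only [List.coe_toFinset, List.mem_filter, List.mem_range, Set.mem_ofPred_eq,
      Nat.ble_eq] at hx
    refine ⟨⟨x, hx.1⟩, ?_, rfl⟩
    rw [mem_support_iff_ncard, ncard_neighborSet_codedGraph]
    exact hx.2
  · by_cases hm : x ∈ maskSet m
    · exact ⟨x, hm, .rfl⟩
    · rw [mem_support_iff_ncard, ncard_neighborSet_codedGraph] at hx
      rcases hout x hm with h3 | ⟨-, a, ha, h3⟩
      · omega
      · simp only [maskList, List.mem_filter, List.mem_range, maskMem_eq_testBit] at ha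
        obtain ⟨-, h4⟩ := trace_sound N 16 a 0 (hexDigit τ a) 0 ha.1
          (Nat.one_le_iff_ne_zero.1 (hin ⟨a, ha.1⟩ ha.2).2.2)
        rcases h4 x x.isLt h3 with h5 | h5
        · simp at h5
        · exact ⟨⟨a, ha.1⟩, ha.2, h5⟩

/-- Every recorded vertex stays related to the start, as each step follows `τ` or `ν`. The final
comparison with `m` says that all ends were recorded. -/
theorem isSingleCycle_sound {τ m : ℕ} {ν : ℕ → ℕ} {x₀ : Fin 16} {r : Fin 16 → Fin 16 → Prop}
    (hr : Equivalence r)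
    (hτ : ∀ x ∈ maskSet m, ∃ y ∈ maskSet m, y.val = hexDigit τ x ∧ r x y)
    (hν : ∀ x ∈ maskSet m, ∃ y ∈ maskSet m, y.val = ν x ∧ r x y) :
    ∀ (k acc : ℕ) (v : Fin 16), v ∈ maskSet m → r x₀ v →
      (∀ x : Fin 16, acc.testBit x = true → r x₀ x) →
      isSingleCycle τ ν m k v acc = true → ∀ x ∈ maskSet m, r x₀ x := by
  intro k
  induction k with
  | zero =>
    intro acc v _ _ hacc h x hx
    rw [isSingleCycle, Nat.beq_eq] at h
    exact hacc x (h ▸ hx)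
  | succ k ih =>
    intro acc v hv hrv hacc h
    rw [isSingleCycle] at h
    obtain ⟨y, hy, hy', hvy⟩ := hτ v hv
    obtain ⟨z, hz, hz', hyz⟩ := hν y hy
    rw [← hy', ← hz'] at h
    have hry := hr.trans hrv hvy
    refine ih _ z hz (hr.trans hry hyz) (fun x hx => ?_) h
    rw [Nat.testBit_lor, Nat.testBit_lor, testBit_one_shiftLeft, testBit_one_shiftLeft,
      Bool.or_eq_true, Bool.or_eq_true, decide_eq_true_eq, decide_eq_true_eq] at hx
    rcases hx with hx | hx | hx
    · exact hacc x hx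
    · rwa [← Fin.ext hx]
    · rwa [← Fin.ext hx]

/-- In the enumeration, follow the branch that always pairs the first remaining element `x` with `P
x`. Along it `ν` agrees with `P` on the elements of `A` already removed from the list. -/
theorem forallPairings_sound {f : (ℕ → ℕ) → Bool} {P : ℕ → ℕ} {A : ℕ → Prop} :
    ∀ (k : ℕ) (L : List ℕ) (ν : ℕ → ℕ), L.Nodup → (∀ x ∈ L, P x ∈ L ∧ P x ≠ x ∧ P (P x) = x) →
      (∀ x, A x → x ∉ L → ν x = P x) → forallPairings f k L ν = true →
      ∃ ν', (∀ x, A x → ν' x = P x) ∧ f ν' = true := by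
  intro k
  induction k with
  | zero =>
    intro L ν _ _ h1 h2
    cases L with
    | nil => exact ⟨ν, fun x hx => h1 x hx (by simp), by simpa [forallPairings] using h2⟩
    | cons x t => simp [forallPairings] at h2
  | succ k ih =>
    intro L ν hd hP h1 h2
    cases L with
    | nil => exact ⟨ν, fun x hx => h1 x hx (by simp), by simpa [forallPairings] using h2⟩
    | cons x t =>
      rw [forallPairings, List.all_eq_true] at h2
      obtain ⟨hx1, hx2, hx3⟩ := hP x (by simp)
      have hy : P x ∈ t := by simpa [hx2] using hx1
      rw [List.nodup_cons] at hd
      refine ih _ _ (hd.2.erase _) (fun z hz => ?_) (fun z hz hz' => ?_) (h2 _ hy)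
      · rw [hd.2.mem_erase_iff] at hz
        obtain ⟨h3, h4, h5⟩ := hP z (by simp [hz.2])
        refine ⟨?_, h4, h5⟩
        rw [hd.2.mem_erase_iff]
        have h6 : P z ≠ x := fun h => hz.1 (by rw [← h, h5])
        refine ⟨fun h => ?_, by simpa [h6] using h3⟩
        have : z = x := by rw [← h5, h, hx3]
        exact hd.1 (this ▸ hz.2)
      · by_cases hzx : z = x
        · simp [hzx]
        · by_cases hzy : z = P x
          · have : Nat.beq (P x) x = false := by
              rw [← Bool.not_eq_true, Nat.beq_eq]; exact hx2
            simp [hzy, this, hx3]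
          · have e1 : Nat.beq z x = false := by rw [← Bool.not_eq_true, Nat.beq_eq]; exact hzx
            have e2 : Nat.beq z (P x) = false := by rw [← Bool.not_eq_true, Nat.beq_eq]; exact hzy
            simp only [e1, e2, cond_false]
            refine h1 z hz ?_
            rw [hd.2.mem_erase_iff] at hz'
            simp only [List.mem_cons, not_or]
            exact ⟨hzx, fun h => hz' ⟨hzy, h⟩⟩

theorem hasLinkages_of_isLinkageFamily {r : ℕ × List (ℕ × ℕ)} (h : isLinkageFamily r = true) :
    HasLinkages (maskSet r.1) := by
  obtain ⟨m, cs⟩ := r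
  intro p hp
  simp only [isLinkageFamily, Bool.and_eq_true, List.all_eq_true] at h
  obtain ⟨h1, h2⟩ := h
  have hmem : ∀ x, x ∈ maskList m ↔ ∃ hx : x < 16, (⟨x, hx⟩ : Fin 16) ∈ maskSet m := by
    intro x
    simp [maskList, maskMem_eq_testBit, maskSet]
  have hnd : (maskList m).Nodup := List.Nodup.filter _ List.nodup_range
  cases hL : maskList m with
  | nil => simp [hL] at h2
  | cons x t =>
    simp only [hL] at h2
    rw [← hL] at h2
    obtain ⟨ν, hν, h3⟩ := forallPairings_sound (A := fun a => a ∈ maskList m)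
      -- The value 0 outside the cube is arbitrary: all members of the list are below 16.
      (P := fun a => if ha : a < 16 then p ⟨a, ha⟩ else 0) 4 (maskList m) _ hnd
      (fun a ha => by
        obtain ⟨ha, ha'⟩ := (hmem a).1 ha
        obtain ⟨h4, h5, h6⟩ := hp _ ha'
        refine ⟨?_, ?_, ?_⟩
        · simp only [ha, dif_pos]
          exact (hmem _).2 ⟨(p ⟨a, ha⟩).isLt, h4⟩
        · simp only [ha, dif_pos]
          exact fun h => h5 (Fin.ext h)
        · simp only [ha, dif_pos, (p ⟨a, ha⟩).isLt, Fin.eta, h6]) (fun a ha ha' => absurd ha ha') h2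
    rw [List.any_eq_true] at h3
    obtain ⟨c, hc, h3⟩ := h3
    obtain ⟨h4, h5, h6⟩ := isLinkage_sound (h1 c hc)
    refine ⟨codedGraph c.1, h4, ?_⟩
    set R := Relation.EqvGen (fun a b => (codedGraph c.1).Adj a b ∨ a ∈ maskSet m ∧ b = p a)
    have hR : Equivalence R := Relation.EqvGen.is_equivalence _
    have hreach : ∀ a b, (codedGraph c.1).Reachable a b → R a b := by
      intro a b hab
      rw [SimpleGraph.reachable_iff_reflTransGen] at hab
      induction hab with
      | refl => exact hR.refl _
      | tail _ h ih => exact hR.trans ih (.rel _ _ (Or.inl h))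
    obtain ⟨hx, hx'⟩ := (hmem x).1 (by simp [hL])
    have h7 := isSingleCycle_sound (x₀ := ⟨x, hx⟩) hR
      (fun a ha => by
        obtain ⟨b, hb, hb', hab⟩ := h5 a ha
        exact ⟨b, hb, hb', hreach _ _ hab⟩)
      (fun a ha => by
        refine ⟨p a, (hp a ha).1, ?_, .rel _ _ (Or.inr ⟨ha, rfl⟩)⟩
        rw [hν a ((hmem a).2 ⟨a.isLt, ha⟩)]
        simp) 4 0 ⟨x, hx⟩ hx' (hR.refl _) (fun a ha => by simp at ha) h3
    have h8 : ∀ a ∈ (codedGraph c.1).support, R ⟨x, hx⟩ a := by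
      intro a ha
      obtain ⟨b, hb, hab⟩ := h6 a ha
      exact hR.trans (h7 b hb) (hreach _ _ hab)
    exact fun a ha b hb => hR.trans (hR.symm (h8 a ha)) (h8 b hb)

/-! ### Symmetry -/

/-- Pull the pairing back along the automorphism, find a linkage there, and carry it forward again.
-/
theorem HasLinkages.of_preimage {A : Set (Fin 16)} (φ : Equiv.Perm (Fin 16))
    (hφ : ∀ x y, fourCube.Adj x y → fourCube.Adj (φ x) (φ y)) (h : HasLinkages (φ ⁻¹' A)) :
    HasLinkages A := by
  intro p hp
  obtain ⟨S, hS, hc⟩ := h (fun x => φ.symm (p (φ x))) (fun x hx => by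
    obtain ⟨h1, h2, h3⟩ := hp (φ x) hx
    refine ⟨by simpa using h1, fun h => h2 (φ.symm_apply_eq.1 h), by simp [h3]⟩)
  have hN : ∀ x, (S.comap φ.symm).neighborSet x = φ '' S.neighborSet (φ.symm x) := by
    intro x
    ext y
    simp [SimpleGraph.mem_neighborSet, φ.image_eq_preimage_symm]
  have hN' : ∀ x, ((S.comap φ.symm).neighborSet x).ncard = (S.neighborSet (φ.symm x)).ncard := by
    intro x
    rw [hN, Set.ncard_image_of_injective _ φ.injective]
  have hsupp : (S.comap φ.symm).support = φ '' S.support := by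
    ext x
    rw [mem_support_iff_ncard, hN', φ.image_eq_preimage_symm, Set.mem_preimage,
      mem_support_iff_ncard]
  refine ⟨S.comap φ.symm, ⟨?_, fun x hx => ?_, fun x hx => ?_, ?_⟩, fun x hx y hy => ?_⟩
  · intro x y hxy
    simpa using hφ _ _ (hS.le hxy)
  · rw [hN']
    exact hS.ends _ (by simpa using hx)
  · rw [hN']
    exact hS.inner _ (by simpa using hx)
  · rw [hsupp, Set.ncard_image_of_injective _ φ.injective]
    exact hS.large
  · rw [hsupp] at hx hy
    obtain ⟨x, hx, rfl⟩ := hx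
    obtain ⟨y, hy, rfl⟩ := hy
    have := hc x hx y hy
    clear hx hy
    induction this with
    | rel a b hab =>
      refine .rel _ _ ?_
      rcases hab with hab | ⟨ha, rfl⟩
      · exact Or.inl (by simpa using hab)
      · exact Or.inr ⟨ha, by simp⟩
    | refl a => exact .refl _
    | symm a b _ ih => exact .symm _ _ ih
    | trans a b c _ _ ih1 ih2 => exact .trans _ _ _ ih1 ih2

/-- The vertex map underlying `swapMask g`. -/
def swapVertex (g : ℕ × ℕ × ℕ) (x : Fin 16) : Fin 16 :=
  if g.2.1.testBit x then Fin.ofNat 16 (x + g.1)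
  else if g.1 ≤ x ∧ g.2.1.testBit (x - g.1) then Fin.ofNat 16 (x - g.1) else x

theorem swapVertex_swapVertex :
    ∀ g ∈ cubeSymmetries, ∀ x, swapVertex g (swapVertex g x) = x := by decide

theorem fourCube_adj_swapVertex : ∀ g ∈ cubeSymmetries, ∀ x y,
    isUnitBit (x.val ^^^ y.val) = true →
      isUnitBit ((swapVertex g x).val ^^^ (swapVertex g y).val) = true := by decide +kernel

/-- A vertex lies in exactly one of three sets: those moved up, those moved down and those fixed. So
exactly one of the three terms of `testBit_swapMask` survives. -/
theorem swapVertex_cases : ∀ g ∈ cubeSymmetries, ∀ x : Fin 16,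
    (g.2.1.testBit x = true ∧ g.2.2.testBit x = false ∧
      (decide (g.1 ≤ x) && g.2.1.testBit (x - g.1)) = false ∧
      (swapVertex g x).val = g.1 + x) ∨
    (g.2.1.testBit x = false ∧ g.2.2.testBit x = false ∧
      (decide (g.1 ≤ x) && g.2.1.testBit (x - g.1)) = true ∧
      (swapVertex g x).val = x - g.1) ∨
    (g.2.1.testBit x = false ∧ g.2.2.testBit x = true ∧
      (decide (g.1 ≤ x) && g.2.1.testBit (x - g.1)) = false ∧
      swapVertex g x = x) := by decide +kernel

theorem swapMask_bounds : ∀ g ∈ cubeSymmetries, g.2.1 <<< g.1 < 2 ^ 16 ∧ g.2.1 < 2 ^ 16 ∧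
    g.2.2 < 2 ^ 16 := by decide

theorem testBit_swapMask (g : ℕ × ℕ × ℕ) (m x : ℕ) :
    (swapMask g m).testBit x =
      ((m.testBit (x - g.1) && (decide (g.1 ≤ x) && g.2.1.testBit (x - g.1))) ||
        ((m.testBit (g.1 + x) && g.2.1.testBit x) || (m.testBit x && g.2.2.testBit x))) := by
  simp only [swapMask, Nat.testBit_lor, Nat.testBit_land, Nat.testBit_shiftLeft,
    Nat.testBit_shiftRight]
  cases m.testBit (x - g.1) <;> simp

theorem maskSet_swapMask {g : ℕ × ℕ × ℕ} (hg : g ∈ cubeSymmetries) (m : ℕ) :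
    maskSet (swapMask g m) = swapVertex g ⁻¹' maskSet m := by
  ext x
  simp only [maskSet, Set.mem_ofPred_eq, Set.mem_preimage, testBit_swapMask]
  rcases swapVertex_cases g hg x with ⟨h1, h2, h3, h4⟩ | ⟨h1, h2, h3, h4⟩ | ⟨h1, h2, h3, h4⟩ <;>
    simp only [h1, h2, h3, h4, Bool.and_false, Bool.and_true, Bool.false_or, Bool.or_false]

theorem swapMask_lt {g : ℕ × ℕ × ℕ} (hg : g ∈ cubeSymmetries) (m : ℕ) :
    swapMask g m < 2 ^ 16 := by
  obtain ⟨h1, h2, h3⟩ := swapMask_bounds g hg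
  refine Nat.or_lt_two_pow ?_ (Nat.or_lt_two_pow ?_ ?_)
  · refine lt_of_le_of_lt ?_ h1
    rw [Nat.shiftLeft_eq, Nat.shiftLeft_eq]
    exact Nat.mul_le_mul_right _ Nat.and_le_right
  · exact lt_of_le_of_lt Nat.and_le_right h2
  · exact lt_of_le_of_lt Nat.and_le_right h3

def swapPerm {g : ℕ × ℕ × ℕ} (hg : g ∈ cubeSymmetries) : Equiv.Perm (Fin 16) where
  toFun := swapVertex g
  invFun := swapVertex g
  left_inv := swapVertex_swapVertex g hg
  right_inv := swapVertex_swapVertex g hg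

theorem isLowered_sound {m : ℕ} (hm : ∀ m' < m, m' < 2 ^ 16 → (maskSet m').ncard = 8 →
      HasLinkages (maskSet m')) :
    ∀ (k m' : ℕ), m' < 2 ^ 16 → (maskSet m').ncard = 8 →
      (HasLinkages (maskSet m') → HasLinkages (maskSet m)) → isLowered k m m' = true →
      HasLinkages (maskSet m) := by
  intro k
  induction k with
  | zero =>
    intro m' h1 h2 h3 h4
    rw [isLowered, Nat.blt_eq] at h4
    exact h3 (hm m' h4 h1 h2)
  | succ k ih =>
    intro m' h1 h2 h3 h4
    rw [isLowered, List.any_eq_true] at h4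
    obtain ⟨g, hg, h4⟩ := h4
    have he : maskSet (swapMask g m') = swapPerm hg ⁻¹' maskSet m' := maskSet_swapMask hg m'
    refine ih _ (swapMask_lt hg m') ?_ (fun h => h3 ?_) h4
    · rw [he, ← Equiv.image_symm_eq_preimage, Set.ncard_image_of_injective _ (Equiv.injective _),
        h2]
    · rw [he] at h
      exact h.of_preimage (swapPerm hg) (fourCube_adj_swapVertex g hg)

theorem forallSubsets_sound {f : ℕ → Bool} : ∀ (n k m : ℕ) (s : Finset ℕ),
    (∀ i ∈ s, i < n) → s.card = k → forallSubsets f n k m = true →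
      f (m + ∑ i ∈ s, 2 ^ i) = true := by
  intro n
  induction n with
  | zero =>
    intro k m s hs hk h
    have : s = ∅ := Finset.eq_empty_of_forall_notMem fun i hi => by simpa using hs i hi
    subst this
    obtain rfl : 0 = k := hk
    simpa [forallSubsets] using h
  | succ n ih =>
    intro k m s hs hk h
    cases k with
    | zero =>
      obtain rfl := Finset.card_eq_zero.1 hk
      simpa [forallSubsets] using h
    | succ k =>
      rw [forallSubsets, Bool.and_eq_true] at h
      by_cases hn : n ∈ s
      · have := ih k (m + 2 ^ n) (s.erase n) (fun i hi => by
          have h1 := hs i (Finset.mem_of_mem_erase hi)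
          have h2 := Finset.ne_of_mem_erase hi
          omega) (by rw [Finset.card_erase_of_mem hn, hk]; rfl) h.2
        rwa [add_assoc, Finset.add_sum_erase s (fun i => 2 ^ i) hn] at this
      · refine ih (k + 1) m s (fun i hi => ?_) hk h.1
        have h1 := hs i hi
        have h2 : i ≠ n := fun h => hn (h ▸ hi)
        omega

theorem isCovered_of_ncard {m : ℕ} (hm : m < 2 ^ 16) (h8 : (maskSet m).ncard = 8) :
    isCovered m = true := by
  have hlt : ∀ i, m.testBit i = true → i < 16 := by
    intro i hi
    by_contra hc
    rw [Nat.testBit_lt_two_pow (lt_of_lt_of_le hm (Nat.pow_le_pow_right two_pos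
      (not_lt.1 hc)))] at hi
    exact Bool.false_ne_true hi
  have := forallSubsets_sound (f := isCovered) 16 8 0 m.bitIndices.toFinset (fun i hi => by
    rw [List.mem_toFinset, Nat.mem_bitIndices] at hi
    exact hlt i hi) (by
      rw [← h8, ← Set.ncard_image_of_injective _ Fin.val_injective, ← Set.ncard_coe_finset]
      congr 1
      ext i
      simp only [List.coe_toFinset, Set.mem_ofPred_eq, Nat.mem_bitIndices, Set.mem_image, maskSet]
      exact ⟨fun h => ⟨⟨i, hlt i h⟩, h, rfl⟩, by rintro ⟨x, hx, rfl⟩; exact hx⟩)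
      forallSubsets_isCovered
  rwa [Finset.sum_toFinset_bitIndices_two_pow, zero_add] at this

theorem hasLinkages_maskSet (m : ℕ) (hm : m < 2 ^ 16) (h8 : (maskSet m).ncard = 8) :
    HasLinkages (maskSet m) := by
  induction m using Nat.strong_induction_on with
  | _ m ih =>
    have h := isCovered_of_ncard hm h8
    simp only [isCovered, Bool.or_eq_true, List.any_eq_true, Nat.beq_eq] at h
    rcases h with h | ⟨r, hr, rfl⟩ | h | h
    · exact isLowered_sound ih 1 m hm h8 id h
    · exact hasLinkages_of_isLinkageFamily (List.all_eq_true.1 linkageTable_all r hr)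
    · exact isLowered_sound ih 2 m hm h8 id h
    · exact isLowered_sound ih 3 m hm h8 id h

/-- Every perfect pairing of eight vertices of the four-dimensional cube can be joined to a single
cycle with at least 12 vertices in the cube by a linkage. -/
theorem hasLinkages_of_ncard_eq_eight {A : Set (Fin 16)} (hA : A.ncard = 8) : HasLinkages A := by
  classical
  set s : Finset ℕ := A.toFinset.map Fin.valEmbedding with hs
  have hbit : ∀ i, (∑ j ∈ s, 2 ^ j).testBit i = true ↔ i ∈ s := by
    intro i
    rw [← Nat.mem_bitIndices, ← List.mem_toFinset, Finset.toFinset_bitIndices_sum_two_pow]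
  have hmask : maskSet (∑ j ∈ s, 2 ^ j) = A := by
    ext x
    change Nat.testBit _ _ = true ↔ _
    rw [hbit, hs]
    simp [Fin.val_inj]
  rw [← hmask]
  refine hasLinkages_maskSet _ (Nat.lt_pow_two_of_testBit _ fun i hi => ?_) (by rw [hmask, hA])
  rw [← Bool.not_eq_true, hbit]
  intro h
  rw [hs, Finset.mem_map] at h
  obtain ⟨x, -, rfl⟩ := h
  exact absurd x.isLt (not_lt.2 hi)

/-! ### Parity and pairings -/

/-- The handshake lemma, applied to the restriction of `S` to the union `c` of components. -/
theorem even_ncard_odd_degree {V : Type*} [Finite V] (S : SimpleGraph V) (c : Set V)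
    (hc : ∀ v w, S.Adj v w → v ∈ c → w ∈ c) :
    Even {v | v ∈ c ∧ Odd (S.neighborSet v).ncard}.ncard := by
  classical
  have := Fintype.ofFinite V
  let S' : SimpleGraph V :=
    { Adj := fun v w => S.Adj v w ∧ v ∈ c
      symm := ⟨fun v w h => ⟨h.1.symm, hc v w h.1 h.2⟩⟩
      loopless := ⟨fun v h => S.loopless.irrefl v h.1⟩ }
  have h := S'.even_card_odd_degree_vertices
  rw [← Set.ncard_coe_finset] at h
  convert h using 2
  ext v
  have hdeg : S'.degree v = (S'.neighborSet v).ncard := by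
    rw [← SimpleGraph.card_neighborSet_eq_degree, Set.ncard_eq_toFinset_card', Set.toFinset_card]
  simp only [Set.mem_ofPred_eq, Finset.coe_filter, Finset.mem_univ, true_and, hdeg]
  by_cases hv : v ∈ c
  · have : S'.neighborSet v = S.neighborSet v := by
      ext w
      exact and_iff_left hv
    rw [this, and_iff_right hv]
  · have : S'.neighborSet v = ∅ := Set.eq_empty_of_forall_notMem fun w h => hv h.2
    simp [this, hv]

/-- Each class meets `A` in an even number of elements, so a member of `A` has an equivalent partner
in `A`. Removing both preserves all parities. -/
theorem exists_pairing {α : Type*} [DecidableEq α] {r : α → α → Prop} [DecidableRel r]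
    (hr : Equivalence r) (A : Finset α) (hA : ∀ x, Even (A.filter (r x)).card) :
    ∃ p : α → α, ∀ x ∈ A, p x ∈ A ∧ p x ≠ x ∧ p (p x) = x ∧ r x (p x) := by
  induction A using Finset.strongInduction with
  | H A ih =>
    rcases A.eq_empty_or_nonempty with rfl | ⟨x, hx⟩
    · exact ⟨id, by simp⟩
    · have hx' : x ∈ A.filter (r x) := by simp [hx, hr.refl x]
      obtain ⟨y, hy, hyx⟩ : ∃ y ∈ A.filter (r x), y ≠ x := by
        refine Finset.exists_mem_ne ?_ x
        have h1 := Finset.card_pos.2 ⟨x, hx'⟩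
        obtain ⟨k, hk⟩ := hA x
        omega
      rw [Finset.mem_filter] at hy
      obtain ⟨hyA, hxy⟩ := hy
      obtain ⟨p, hp⟩ := ih ((A.erase x).erase y)
        ((Finset.erase_subset _ _).trans_ssubset (Finset.erase_ssubset hx)) (fun z => by
          rw [Finset.filter_erase, Finset.filter_erase]
          by_cases hz : r z x
          · have h1 : x ∈ A.filter (r z) := by simp [hx, hz]
            have h2 : y ∈ (A.filter (r z)).erase x := by
              simp [hyx, hyA, hr.trans hz hxy]
            have h3 := hA z
            have h4 := Finset.card_pos.2 ⟨y, h2⟩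
            rw [Finset.card_erase_of_mem h1] at h4
            rw [Finset.card_erase_of_mem h2, Finset.card_erase_of_mem h1]
            rw [Nat.even_iff] at h3 ⊢
            omega
          · have h1 : x ∉ A.filter (r z) := by simp [hz]
            have h2 : y ∉ A.filter (r z) := by
              simp only [Finset.mem_filter, not_and]
              exact fun _ h => hz (hr.trans h (hr.symm hxy))
            rw [Finset.erase_eq_of_notMem h1, Finset.erase_eq_of_notMem h2]
            exact hA z)
      refine ⟨fun z => if z = x then y else if z = y then x else p z, fun z hz => ?_⟩
      by_cases h1 : z = x
      · subst h1
        simp [hyx, hyA, hxy]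
      · by_cases h2 : z = y
        · subst h2
          simp [h1, hx, Ne.symm h1, hr.symm hxy]
        · obtain ⟨h3, h4, h5, h6⟩ := hp z (by simp [h1, h2, hz])
          simp only [Finset.mem_erase] at h3
          simp [h1, h2, h3, h4, h5, h6]

/-! ### Joining linkages of all blocks -/

section Blocks

variable {V I : Type*} (e : V ≃ I × Fin 16)

/-- The disjoint union of graphs in the blocks of `e`. -/
def blockGraph (T : I → SimpleGraph (Fin 16)) : SimpleGraph V where
  Adj v w := (e v).1 = (e w).1 ∧ (T (e v).1).Adj (e v).2 (e w).2
  symm := ⟨fun _ _ h => ⟨h.1.symm, h.1 ▸ h.2.symm⟩⟩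
  loopless := ⟨fun v h => (T (e v).1).loopless.irrefl _ h.2⟩

/-- The trace of a vertex set on the block `u`. -/
def blockTrace (s : Set V) (u : I) : Set (Fin 16) := {x | e.symm (u, x) ∈ s}

variable {e}

theorem blockGraph_mono {T T' : I → SimpleGraph (Fin 16)} (h : T ≤ T') :
    blockGraph e T ≤ blockGraph e T' :=
  fun v _ hvw => ⟨hvw.1, h (e v).1 hvw.2⟩

theorem neighborSet_blockGraph (T : I → SimpleGraph (Fin 16)) (v : V) :
    (blockGraph e T).neighborSet v =
      (fun x => e.symm ((e v).1, x)) '' (T (e v).1).neighborSet (e v).2 := by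
  ext w
  constructor
  · rintro ⟨h1, h2⟩
    exact ⟨(e w).2, h2, by simp [h1]⟩
  · rintro ⟨x, hx, rfl⟩
    refine ⟨by simp, ?_⟩
    simpa using hx

theorem ncard_neighborSet_blockGraph (T : I → SimpleGraph (Fin 16)) (v : V) :
    ((blockGraph e T).neighborSet v).ncard = ((T (e v).1).neighborSet (e v).2).ncard := by
  rw [neighborSet_blockGraph, Set.ncard_image_of_injective]
  intro x y h
  simpa using h

theorem mem_support_blockGraph (T : I → SimpleGraph (Fin 16)) (v : V) :
    v ∈ (blockGraph e T).support ↔ (e v).2 ∈ (T (e v).1).support := by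
  constructor
  · rintro ⟨w, h⟩
    exact ⟨_, h.2⟩
  · rintro ⟨x, h⟩
    exact ⟨e.symm ((e v).1, x), by simp, by simpa using h⟩

variable (e) in
/-- All vertices of the block `u` on edges of the blocks lie in the same component of the union
with `M`. -/
def BlockConnected (M : SimpleGraph V) (T : I → SimpleGraph (Fin 16)) (u : I) : Prop :=
  ∀ x ∈ (T u).support, ∀ y ∈ (T u).support,
    (M ⊔ blockGraph e T).Reachable (e.symm (u, x)) (e.symm (u, y))

variable {M : SimpleGraph V}

theorem ncard_neighborSet_of_matching (hM : ∀ v a b, M.Adj v a → M.Adj v b → a = b) {v : V}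
    (hv : v ∈ M.support) : (M.neighborSet v).ncard = 1 := by
  obtain ⟨w, hw⟩ := hv
  rw [Set.ncard_eq_one]
  refine ⟨w, ?_⟩
  ext x
  exact ⟨fun hx => hM v x w hx hw, by rintro rfl; exact hw⟩

/-- A walk between vertices outside block `w` enters and leaves that block only along edges of `M`,
hence at ends of `M`. All of these are connected to `a` after the update, so each excursion into the
block can be replaced. -/
theorem reachable_of_update [DecidableEq I] {T : I → SimpleGraph (Fin 16)} {w : I}
    {L : SimpleGraph (Fin 16)} {a : V}
    (ha : ∀ v ∈ M.support, (e v).1 = w → (M ⊔ blockGraph e (Function.update T w L)).Reachable a v)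
    {x y : V} (hx : (e x).1 ≠ w) (hy : (e y).1 ≠ w) (h : (M ⊔ blockGraph e T).Reachable x y) :
    (M ⊔ blockGraph e (Function.update T w L)).Reachable x y := by
  rw [SimpleGraph.reachable_iff_reflTransGen] at h
  -- While the old walk is inside block `w`, its current vertex may be isolated in the new graph;
  -- the invariant then keeps track of `a` instead.
  suffices h' : ((e y).1 = w → (M ⊔ blockGraph e (Function.update T w L)).Reachable x a) ∧
      ((e y).1 ≠ w → (M ⊔ blockGraph e (Function.update T w L)).Reachable x y) from h'.2 hy
  clear hy
  induction h with
  | refl => exact ⟨fun h => absurd h hx, fun _ => .rfl⟩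
  | @tail b c _ hbc ih =>
    rcases hbc with hbc | hbc
    · have hadj : (M ⊔ blockGraph e (Function.update T w L)).Adj b c := Or.inl hbc
      have hb : (M ⊔ blockGraph e (Function.update T w L)).Reachable x b := by
        by_cases hbw : (e b).1 = w
        · exact (ih.1 hbw).trans (ha b ⟨c, hbc⟩ hbw)
        · exact ih.2 hbw
      exact ⟨fun hcw => (hb.trans hadj.reachable).trans (ha c ⟨b, hbc.symm⟩ hcw).symm,
        fun _ => hb.trans hadj.reachable⟩
    · by_cases hbw : (e b).1 = w
      · exact ⟨fun _ => ih.1 hbw, fun hcw => absurd (hbc.1 ▸ hbw) hcw⟩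
      · have hadj : (M ⊔ blockGraph e (Function.update T w L)).Adj b c :=
          Or.inr ⟨hbc.1, by simpa [Function.update_of_ne hbw] using hbc.2⟩
        exact ⟨fun hcw => absurd (hbc.1.trans hcw) hbw,
          fun _ => (ih.2 hbw).trans hadj.reachable⟩

/-- In one component, the odd vertices of `M` are all ends of `M`, and those of the block graph with
block `w` emptied are the ends outside `w`. Both numbers are even, hence so is the number of ends in
`w`. -/
theorem even_ncard_component_trace [Finite V] [DecidableEq I]
    (hM : ∀ v a b, M.Adj v a → M.Adj v b → a = b) {T : I → SimpleGraph (Fin 16)} {w : I}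
    (hT : ∀ u ≠ w, IsLinkage (blockTrace e M.support u) (T u)) (x : V) :
    Even {y | (M ⊔ blockGraph e (Function.update T w ⊥)).Reachable x y ∧ y ∈ M.support ∧
      (e y).1 = w}.ncard := by
  set R := M ⊔ blockGraph e (Function.update T w ⊥)
  have h1 := even_ncard_odd_degree M {y | R.Reachable x y}
    (fun a b hab ha => SimpleGraph.Reachable.trans ha (SimpleGraph.Adj.reachable (Or.inl hab)))
  have h2 := even_ncard_odd_degree (blockGraph e (Function.update T w ⊥)) {y | R.Reachable x y}
    (fun a b hab ha => SimpleGraph.Reachable.trans ha (SimpleGraph.Adj.reachable (Or.inr hab)))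
  have e1 : {v | v ∈ {y | R.Reachable x y} ∧ Odd (M.neighborSet v).ncard} =
      {y | R.Reachable x y ∧ y ∈ M.support ∧ (e y).1 = w} ∪
      {y | R.Reachable x y ∧ y ∈ M.support ∧ (e y).1 ≠ w} := by
    ext v
    have : Odd (M.neighborSet v).ncard ↔ v ∈ M.support := by
      refine ⟨fun h => ?_, fun h => ?_⟩
      · rw [mem_support_iff_ncard]
        exact h.pos
      · rw [ncard_neighborSet_of_matching hM h]
        exact odd_one
    simp only [Set.mem_ofPred_eq, Set.mem_union, this]
    tauto
  have e2 : {v | v ∈ {y | R.Reachable x y} ∧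
      Odd ((blockGraph e (Function.update T w ⊥)).neighborSet v).ncard} =
      {y | R.Reachable x y ∧ y ∈ M.support ∧ (e y).1 ≠ w} := by
    ext v
    simp only [Set.mem_ofPred_eq]
    refine and_congr_right fun _ => ?_
    rw [ncard_neighborSet_blockGraph]
    by_cases hv : (e v).1 = w
    · simp [hv]
    · rw [Function.update_of_ne hv]
      have hm : (e v).2 ∈ blockTrace e M.support (e v).1 ↔ v ∈ M.support := by
        simp [blockTrace]
      by_cases hs : v ∈ M.support
      · rw [(hT _ hv).ends _ (hm.2 hs)]
        simp [hs, hv]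
      · rcases (hT _ hv).inner _ (fun h => hs (hm.1 h)) with h | h <;> rw [h] <;> simp [hs]
  rw [e2] at h2
  rw [e1, Set.ncard_union_eq ?_ (Set.toFinite _) (Set.toFinite _)] at h1
  · rw [Nat.even_add] at h1
    exact h1.2 h2
  · rw [Set.disjoint_left]
    exact fun v h h' => h'.2.2 h.2.2

theorem exists_linkage_connected [Finite V] [DecidableEq I]
    (hM : ∀ v a b, M.Adj v a → M.Adj v b → a = b) {T : I → SimpleGraph (Fin 16)} {w : I}
    (h8 : (blockTrace e M.support w).ncard = 8)
    (hT : ∀ u ≠ w, IsLinkage (blockTrace e M.support u) (T u)) :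
    ∃ L, IsLinkage (blockTrace e M.support w) L ∧
      BlockConnected e M (Function.update T w L) w ∧
      ∀ u ≠ w, BlockConnected e M T u → BlockConnected e M (Function.update T w L) u := by
  classical
  set R := M ⊔ blockGraph e (Function.update T w ⊥) with hR
  let r : Fin 16 → Fin 16 → Prop := fun x y => R.Reachable (e.symm (w, x)) (e.symm (w, y))
  have hr : Equivalence r := ⟨fun _ => .rfl, fun h => h.symm, fun h h' => h.trans h'⟩
  obtain ⟨p, hp⟩ := exists_pairing hr (blockTrace e M.support w).toFinset (fun x => by
    have h := even_ncard_component_trace hM hT (e.symm (w, x))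
    rw [← hR] at h
    convert h using 1
    rw [← Set.ncard_coe_finset, ← Set.ncard_image_of_injective (f := fun y => e.symm (w, y)) _
      (fun y z h => by simpa using h)]
    congr 1
    ext v
    simp only [Finset.coe_filter, Set.mem_toFinset, Set.mem_ofPred_eq, Set.mem_image, r]
    constructor
    · rintro ⟨y, ⟨h1, h2⟩, rfl⟩
      exact ⟨h2, h1, by simp⟩
    · rintro ⟨h1, h2, rfl⟩
      exact ⟨(e v).2, ⟨by simpa [blockTrace] using h2, by simpa using h1⟩, by simp⟩)
  simp only [Set.mem_toFinset] at hp
  obtain ⟨L, hL, hc⟩ := hasLinkages_of_ncard_eq_eight h8 p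
    (fun x hx => ⟨(hp x hx).1, (hp x hx).2.1, (hp x hx).2.2.1⟩)
  -- Connections that avoid the edges of block `w` survive any choice of `L`; they realise the edges
  -- of the pairing `p`.
  have hle : R ≤ M ⊔ blockGraph e (Function.update T w L) := by
    refine sup_le_sup_left (blockGraph_mono ?_) _
    exact update_le_update_iff.2 ⟨bot_le, fun _ _ => le_rfl⟩
  have hw : BlockConnected e M (Function.update T w L) w := by
    intro x hx y hy
    rw [Function.update_self] at hx hy
    have h := hc x hx y hy
    clear hx hy
    induction h with
    | rel a b hab =>
      rcases hab with hab | ⟨ha, rfl⟩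
      · exact SimpleGraph.Adj.reachable (Or.inr ⟨by simp, by simpa using hab⟩)
      · exact (hp a ha).2.2.2.mono hle
    | refl a => exact .rfl
    | symm a b _ ih => exact ih.symm
    | trans a b c _ _ ih1 ih2 => exact ih1.trans ih2
  refine ⟨L, hL, hw, fun u hu h x hx y hy => ?_⟩
  obtain ⟨a, ha⟩ : (blockTrace e M.support w).Nonempty := by
    rw [← Set.ncard_pos]; omega
  have hsupp : ∀ b ∈ blockTrace e M.support w, b ∈ L.support := fun b hb => by
    rw [mem_support_iff_ncard, hL.ends b hb]
  rw [Function.update_of_ne hu] at hx hy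
  refine reachable_of_update (a := e.symm (w, a)) (fun v hv hvw => ?_) (by simpa using hu)
    (by simpa using hu) (h x hx y hy)
  have hv' : (e v).2 ∈ blockTrace e M.support w := by
    rw [← hvw]; simpa [blockTrace] using hv
  have := hw a (by simpa using hsupp a ha) (e v).2 (by simpa using hsupp _ hv')
  rw [← hvw] at this ⊢
  simpa using this

theorem exists_linkages_connected [Finite V] [Finite I]
    (hM : ∀ v a b, M.Adj v a → M.Adj v b → a = b)
    (h8 : ∀ u, (blockTrace e M.support u).ncard = 8) :
    ∃ T : I → SimpleGraph (Fin 16), (∀ u, IsLinkage (blockTrace e M.support u) (T u)) ∧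
      ∀ u, BlockConnected e M T u := by
  classical
  have := Fintype.ofFinite I
  suffices h : ∀ s : Finset I, ∃ T : I → SimpleGraph (Fin 16),
      (∀ u, IsLinkage (blockTrace e M.support u) (T u)) ∧ ∀ u ∈ s, BlockConnected e M T u by
    obtain ⟨T, h1, h2⟩ := h Finset.univ
    exact ⟨T, h1, fun u => h2 u (Finset.mem_univ u)⟩
  intro s
  induction s using Finset.induction_on with
  | empty =>
    have h : ∀ u, ∃ L, IsLinkage (blockTrace e M.support u) L := by
      intro u
      -- The initial linkages need not connect anything, so any pairing of the eight ends will do.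
      obtain ⟨p, hp⟩ := exists_pairing (r := fun _ _ : Fin 16 => True)
        ⟨fun _ => trivial, fun _ => trivial, fun _ _ => trivial⟩
        (blockTrace e M.support u).toFinset (fun x => by
          rw [Finset.filter_true, ← Set.ncard_eq_toFinset_card', h8]
          decide)
      simp only [Set.mem_toFinset] at hp
      obtain ⟨L, hL, -⟩ := hasLinkages_of_ncard_eq_eight (h8 u) p
        (fun x hx => ⟨(hp x hx).1, (hp x hx).2.1, (hp x hx).2.2.1⟩)
      exact ⟨L, hL⟩
    choose T hT using h
    exact ⟨T, hT, by simp⟩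
  | insert w s hw ih =>
    obtain ⟨T, h1, h2⟩ := ih
    obtain ⟨L, hL, h3, h4⟩ := exists_linkage_connected hM (h8 w) (T := T) fun u _ => h1 u
    refine ⟨Function.update T w L, fun u => ?_, fun u hu => ?_⟩
    · by_cases huw : u = w
      · subst huw; simpa using hL
      · simpa [huw] using h1 u
    · by_cases huw : u = w
      · exact huw ▸ h3
      · exact h4 u huw (h2 u ((Finset.mem_insert.1 hu).resolve_left huw))

/-- A matching with eight ends in every block, whose edges connect the blocks, extends by edges
within the blocks to a single cycle that contains at least three quarters of all vertices. -/
theorem exists_isCycles_of_eight [Finite V] [Finite I]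
    (hM : ∀ v a b, M.Adj v a → M.Adj v b → a = b)
    (h8 : ∀ u, (blockTrace e M.support u).ncard = 8)
    (hlink : ∀ u v : I, Relation.EqvGen (fun u v => ∃ a b, M.Adj a b ∧ (e a).1 = u ∧ (e b).1 = v) u v) :
    ∃ S : SimpleGraph V,
      (∀ v w, S.Adj v w → (e v).1 = (e w).1 ∧ fourCube.Adj (e v).2 (e w).2) ∧
      (M ⊔ S).IsCycles ∧
      (∀ v ∈ (M ⊔ S).support, ∀ w ∈ (M ⊔ S).support, (M ⊔ S).Reachable v w) ∧
      12 * Nat.card I ≤ (M ⊔ S).support.ncard := by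
  classical
  have := Fintype.ofFinite I
  have := Fintype.ofFinite V
  obtain ⟨T, hT, hc⟩ := exists_linkages_connected hM h8
  have hMT : M.support ⊆ (blockGraph e T).support := by
    intro v hv
    rw [mem_support_blockGraph, mem_support_iff_ncard, (hT _).ends]
    simpa [blockTrace] using hv
  have hsup : (M ⊔ blockGraph e T).support = (blockGraph e T).support := by
    refine Set.Subset.antisymm ?_ (SimpleGraph.support_mono le_sup_right)
    rintro v ⟨w, h | h⟩
    · exact hMT ⟨w, h⟩
    · exact ⟨w, h⟩
  have hblock : ∀ v ∈ (blockGraph e T).support, ∀ w ∈ (blockGraph e T).support,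
      (e v).1 = (e w).1 → (M ⊔ blockGraph e T).Reachable v w := by
    intro v hv w hw h
    have := hc (e v).1 (e v).2 ((mem_support_blockGraph T v).1 hv) (e w).2
      (h ▸ (mem_support_blockGraph T w).1 hw)
    have e1 : e.symm ((e v).1, (e v).2) = v := by simp
    have e2 : e.symm ((e v).1, (e w).2) = w := by simp [h]
    rwa [e1, e2] at this
  have hconn : ∀ v ∈ (blockGraph e T).support, ∀ w ∈ (blockGraph e T).support,
      (M ⊔ blockGraph e T).Reachable v w := by
    suffices h : ∀ u u', Relation.EqvGen (fun u v => ∃ a b, M.Adj a b ∧ (e a).1 = u ∧ (e b).1 = v)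
        u u' → ∀ v ∈ (blockGraph e T).support, ∀ w ∈ (blockGraph e T).support,
        (e v).1 = u → (e w).1 = u' → (M ⊔ blockGraph e T).Reachable v w from
      fun v hv w hw => h _ _ (hlink (e v).1 (e w).1) v hv w hw rfl rfl
    intro u u' h
    induction h with
    | rel u u' h =>
      obtain ⟨a, b, hab, rfl, rfl⟩ := h
      intro v hv w hw h1 h2
      exact ((hblock v hv a (hMT ⟨b, hab⟩) h1).trans
        (SimpleGraph.Adj.reachable (Or.inl hab))).trans
        (hblock b (hMT ⟨a, hab.symm⟩) w hw h2.symm)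
    | refl u =>
      intro v hv w hw h1 h2
      exact hblock v hv w hw (h1.trans h2.symm)
    | symm u u' _ ih =>
      intro v hv w hw h1 h2
      exact (ih w hw v hv h2 h1).symm
    | trans u₁ u₂ u₃ _ _ ih1 ih2 =>
      intro v hv w hw h1 h2
      -- Transitivity needs an actual vertex in the middle block; one of its eight ends serves.
      obtain ⟨x, hx⟩ : (blockTrace e M.support u₂).Nonempty := by
        rw [← Set.ncard_pos, h8]; omega
      exact (ih1 v hv _ (hMT hx) h1 (by simp)).trans (ih2 _ (hMT hx) w hw (by simp) h2)
  refine ⟨blockGraph e T, fun v w h => ⟨h.1, (hT _).le h.2⟩, ?_, ?_, ?_⟩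
  · intro v hv
    have hN : (M ⊔ blockGraph e T).neighborSet v =
      M.neighborSet v ∪ (blockGraph e T).neighborSet v := rfl
    by_cases hvM : v ∈ M.support
    · have hdeg : ∀ z ∈ M.support, ((blockGraph e T).neighborSet z).ncard = 1 := by
        intro z hz
        rw [ncard_neighborSet_blockGraph]
        exact (hT _).ends _ (by simpa [blockTrace] using hz)
      have h1 := ncard_neighborSet_of_matching hM hvM
      rw [hN, Set.ncard_union_eq ?_ (Set.toFinite _) (Set.toFinite _), h1, hdeg v hvM]
      -- An edge `va` in both `M` and a linkage would be a whole component. But that component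
      -- contains the at least 12 linkage vertices of the block of `v`.
      rw [Set.disjoint_left]
      intro a ha ha'
      have hone : ∀ z ∈ M.support, ∀ b c, (M ⊔ blockGraph e T).Adj z b →
          M.Adj z c → (blockGraph e T).Adj z c → b = c := by
        rintro z hz b c (hb | hb) hc hc'
        · exact hM z b c hb hc
        · obtain ⟨d, hd⟩ := Set.ncard_eq_one.1 (hdeg z hz)
          have hb' : b ∈ (blockGraph e T).neighborSet z := hb
          have hc'' : c ∈ (blockGraph e T).neighborSet z := hc'
          rw [hd, Set.mem_singleton_iff] at hb' hc''
          rw [hb', hc'']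
      have hreach : ∀ y, (M ⊔ blockGraph e T).Reachable v y → y = v ∨ y = a := by
        intro y hy
        rw [SimpleGraph.reachable_iff_reflTransGen] at hy
        induction hy with
        | refl => exact Or.inl rfl
        | tail _ hbc ih =>
          rcases ih with rfl | rfl
          · exact Or.inr (hone _ hvM _ a hbc ha ha')
          · exact Or.inl (hone _ ⟨v, SimpleGraph.Adj.symm ha⟩ _ v hbc (SimpleGraph.Adj.symm ha)
              (SimpleGraph.Adj.symm ha'))
      have hlarge := (hT (e v).1).large
      have hle : (T (e v).1).support ⊆ {(e v).2, (e a).2} := by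
        intro x hx
        have hs : e.symm ((e v).1, x) ∈ (blockGraph e T).support := by
          rw [mem_support_blockGraph]; simpa using hx
        rcases hreach _ (hblock v (hMT hvM) _ hs (by simp)) with h | h
        · left; rw [← h]; simp
        · right; rw [← h]; simp
      have := (Set.ncard_le_ncard hle (Set.toFinite _)).trans (Set.ncard_insert_le _ _)
      rw [Set.ncard_singleton] at this
      omega
    · have : M.neighborSet v = ∅ := Set.eq_empty_of_forall_notMem fun w h => hvM ⟨w, h⟩
      rw [hN, this, Set.empty_union] at hv ⊢
      rw [ncard_neighborSet_blockGraph]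
      rw [← Set.ncard_pos, ncard_neighborSet_blockGraph] at hv
      rcases (hT (e v).1).inner (e v).2 (fun h => hvM (by simpa [blockTrace] using h)) with h | h
      · omega
      · exact h
  · rw [hsup]
    exact hconn
  · rw [hsup, Nat.card_eq_fintype_card, Set.ncard_eq_toFinset_card',
      Finset.card_eq_sum_card_fiberwise (f := fun v => (e v).1) (t := Finset.univ)
        (fun _ _ => Finset.mem_coe.2 (Finset.mem_univ _)), mul_comm, ← smul_eq_mul,
      ← Finset.card_univ]
    refine Finset.card_nsmul_le_sum _ _ _ fun u _ => ?_
    refine (hT u).large.trans ?_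
    rw [← Set.ncard_coe_finset,
      ← Set.ncard_image_of_injective (f := fun x => e.symm (u, x)) _
        (fun y z h => by simpa using h)]
    refine Set.ncard_le_ncard ?_ (Set.toFinite _)
    rintro _ ⟨x, hx, rfl⟩
    simp only [Finset.coe_filter, Set.mem_toFinset, Set.mem_ofPred_eq, mem_support_blockGraph]
    simpa using hx

end Blocks

/-! ### Extending a matching to eight ends in every block -/

section Padding

variable {V I : Type*} (e : V ≃ I × Fin 16) (O : SimpleGraph I)

/-- The matching `M'` extends `M` by edges of the product of `O` with the four-dimensional cube. -/
structure ExtendsMatching (M M' : SimpleGraph V) : Prop where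
  le : M ≤ M'
  matching : ∀ v a b, M'.Adj v a → M'.Adj v b → a = b
  new : ∀ v w, M'.Adj v w → M.Adj v w ∨
    ((e v).1 = (e w).1 ∧ fourCube.Adj (e v).2 (e w).2 ∨
      O.Adj (e v).1 (e w).1 ∧ (e v).2 = (e w).2)

/-- The number of ends of `M` in the block `u`. -/
noncomputable def endCount (M : SimpleGraph V) (u : I) : ℕ := (blockTrace e M.support u).ncard

variable {e O}

theorem ExtendsMatching.trans {M M' M'' : SimpleGraph V} (h : ExtendsMatching e O M M')
    (h' : ExtendsMatching e O M' M'') : ExtendsMatching e O M M'' :=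
  ⟨h.le.trans h'.le, h'.matching, fun v w hvw => by
    rcases h'.new v w hvw with h1 | h1
    · exact h.new v w h1
    · exact Or.inr h1⟩

theorem exists_extendsMatching_edge {M : SimpleGraph V}
    (hM : ∀ v a b, M.Adj v a → M.Adj v b → a = b) {a b : V} (ha : a ∉ M.support)
    (hb : b ∉ M.support) (hab : (e a).1 = (e b).1 ∧ fourCube.Adj (e a).2 (e b).2 ∨
      O.Adj (e a).1 (e b).1 ∧ (e a).2 = (e b).2) :
    ∃ M', ExtendsMatching e O M M' ∧ M'.Adj a b ∧ M'.support = insert a (insert b M.support) := by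
  have hne : a ≠ b := by
    rintro rfl
    rcases hab with h | h
    · exact fourCube.loopless.irrefl _ h.2
    · exact O.loopless.irrefl _ h.1
  have hadj : ∀ v w, (M ⊔ SimpleGraph.edge a b).Adj v w ↔
      M.Adj v w ∨ (v = a ∧ w = b ∨ v = b ∧ w = a) := by
    intro v w
    rw [SimpleGraph.sup_adj, SimpleGraph.edge_adj]
    constructor
    · tauto
    · rintro (h | ⟨rfl, rfl⟩ | ⟨rfl, rfl⟩)
      · exact Or.inl h
      · exact Or.inr ⟨Or.inl ⟨rfl, rfl⟩, hne⟩
      · exact Or.inr ⟨Or.inr ⟨rfl, rfl⟩, hne.symm⟩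
  refine ⟨M ⊔ SimpleGraph.edge a b, ⟨le_sup_left, fun v x y hx hy => ?_, fun v w h => ?_⟩,
    (hadj a b).2 (Or.inr (Or.inl ⟨rfl, rfl⟩)), ?_⟩
  · rw [hadj] at hx hy
    rcases hx with hx | ⟨rfl, rfl⟩ | ⟨rfl, rfl⟩ <;> rcases hy with hy | ⟨h1, rfl⟩ | ⟨h1, rfl⟩
    · exact hM v x y hx hy
    · exact absurd ⟨x, h1 ▸ hx⟩ ha
    · exact absurd ⟨x, h1 ▸ hx⟩ hb
    · exact absurd ⟨y, hy⟩ ha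
    · rfl
    · exact absurd h1 hne
    · exact absurd ⟨y, hy⟩ hb
    · exact absurd h1.symm hne
    · rfl
  · rw [hadj] at h
    rcases h with h | ⟨rfl, rfl⟩ | ⟨rfl, rfl⟩
    · exact Or.inl h
    · exact Or.inr hab
    · refine Or.inr (hab.imp (fun h => ⟨h.1.symm, h.2.symm⟩) fun h => ⟨h.1.symm, h.2.symm⟩)
  · ext v
    simp only [SimpleGraph.mem_support, hadj, Set.mem_insert_iff]
    constructor
    · rintro ⟨w, h | ⟨rfl, -⟩ | ⟨rfl, -⟩⟩
      · exact Or.inr (Or.inr ⟨w, h⟩)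
      · exact Or.inl rfl
      · exact Or.inr (Or.inl rfl)
    · rintro (rfl | rfl | ⟨w, h⟩)
      · exact ⟨b, Or.inr (Or.inl ⟨rfl, rfl⟩)⟩
      · exact ⟨a, Or.inr (Or.inr ⟨rfl, rfl⟩)⟩
      · exact ⟨w, Or.inl h⟩

open Classical in
theorem blockTrace_insert (a : V) (s : Set V) (u : I) : blockTrace e (insert a s) u =
    if (e a).1 = u then insert (e a).2 (blockTrace e s u) else blockTrace e s u := by
  ext x
  have h1 : e.symm (u, x) = a ↔ (e a).1 = u ∧ x = (e a).2 := by
    rw [Equiv.symm_apply_eq, Prod.ext_iff]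
    simp only
    tauto
  split_ifs with h
  · simp [blockTrace, h1, h]
  · simp [blockTrace, h1, h]

/-- With at most 15 ends in the two blocks together, one of the 16 positions is free in both. -/
theorem exists_link {M : SimpleGraph V} (hM : ∀ v a b, M.Adj v a → M.Adj v b → a = b) {u v : I}
    (huv : O.Adj u v) (hc : endCount e M u + endCount e M v ≤ 15) :
    ∃ M', ExtendsMatching e O M M' ∧ (∃ a b, M'.Adj a b ∧ (e a).1 = u ∧ (e b).1 = v) ∧
      endCount e M' u = endCount e M u + 1 ∧ endCount e M' v = endCount e M v + 1 ∧
      ∀ w, w ≠ u → w ≠ v → endCount e M' w = endCount e M w := by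
  obtain ⟨x, hx⟩ : ∃ x, x ∉ blockTrace e M.support u ∪ blockTrace e M.support v := by
    by_contra! h
    have h1 := Set.ncard_union_le (blockTrace e M.support u) (blockTrace e M.support v)
    rw [Set.eq_univ_of_forall h, Set.ncard_univ, Nat.card_fin] at h1
    simp only [endCount] at hc
    omega
  rw [Set.mem_union, not_or] at hx
  have hne := huv.ne
  obtain ⟨M', h1, h2, h3⟩ := exists_extendsMatching_edge (e := e) (O := O) hM
    (a := e.symm (u, x)) (b := e.symm (v, x)) hx.1 hx.2 (Or.inr (by simpa using huv))
  refine ⟨M', h1, ⟨_, _, h2, by simp, by simp⟩, ?_, ?_, fun w hu hv => ?_⟩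
  · simp only [endCount, h3, blockTrace_insert, Equiv.apply_symm_apply, if_true, hne.symm, if_false]
    exact Set.ncard_insert_of_notMem hx.1
  · simp only [endCount, h3, blockTrace_insert, Equiv.apply_symm_apply, if_true, hne, if_false]
    exact Set.ncard_insert_of_notMem hx.2
  · simp only [endCount, h3, blockTrace_insert, Equiv.apply_symm_apply, hu.symm, hv.symm, if_false]

/-- The eight disjoint edges `{2k, 2k + 1}` cannot all be hit by fewer than eight vertices. -/
theorem exists_fourCube_adj_notMem {A : Set (Fin 16)} (hA : A.ncard ≤ 6) :
    ∃ x y, fourCube.Adj x y ∧ x ∉ A ∧ y ∉ A := by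
  by_contra! h
  have h1 : ∀ k : Fin 8, ∃ x ∈ A, x.val / 2 = k.val := by
    intro k
    have hk := k.isLt
    by_cases hx : (⟨2 * k.val, by omega⟩ : Fin 16) ∈ A
    · exact ⟨_, hx, by simp⟩
    · refine ⟨⟨2 * k.val + 1, by omega⟩, h _ _ ?_ hx, by simp; omega⟩
      exact (by decide : ∀ k : Fin 8, isUnitBit ((2 * k.val) ^^^ (2 * k.val + 1)) = true) k
  choose f hf hf' using h1
  have hinj : Function.Injective f := fun i j hij => Fin.ext (by rw [← hf' i, ← hf' j, hij])
  have := Set.ncard_le_ncard (Set.range_subset_iff.2 hf) (Set.toFinite _)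
  rw [← Set.image_univ, Set.ncard_image_of_injective _ hinj, Set.ncard_univ, Nat.card_fin] at this
  omega

theorem exists_pad {u : I} : ∀ (k : ℕ) {M : SimpleGraph V},
    (∀ v a b, M.Adj v a → M.Adj v b → a = b) → endCount e M u + 2 * k = 8 →
    ∃ M', ExtendsMatching e O M M' ∧ endCount e M' u = 8 ∧
      ∀ w, w ≠ u → endCount e M' w = endCount e M w := by
  intro k
  induction k with
  | zero =>
    intro M hM h
    exact ⟨M, ⟨le_rfl, hM, fun _ _ h => Or.inl h⟩, h, fun _ _ => rfl⟩
  | succ k ih =>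
    intro M hM h
    obtain ⟨x, y, hxy, hx, hy⟩ := exists_fourCube_adj_notMem
      (A := blockTrace e M.support u) (by simp only [endCount] at h; omega)
    obtain ⟨M', h1, -, h3⟩ := exists_extendsMatching_edge (e := e) (O := O) hM
      (a := e.symm (u, x)) (b := e.symm (u, y)) hx hy (Or.inl (by simpa using hxy))
    have hu : endCount e M' u = endCount e M u + 2 := by
      simp only [endCount, h3, blockTrace_insert, Equiv.apply_symm_apply, if_true]
      rw [Set.ncard_insert_of_notMem, Set.ncard_insert_of_notMem hy]
      rw [Set.mem_insert_iff, not_or]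
      exact ⟨hxy.ne, hx⟩
    have hw : ∀ w, w ≠ u → endCount e M' w = endCount e M w := by
      intro w hw
      simp only [endCount, h3, blockTrace_insert, Equiv.apply_symm_apply, hw.symm, if_false]
    obtain ⟨M'', h4, h5, h6⟩ := ih h1.matching (by omega)
    exact ⟨M'', h1.trans h4, h5, fun w h => (h6 w h).trans (hw w h)⟩

/-- Induction along the path. The first block has received up to two ends from its predecessor: an
inner block then has at most 5 + 2 = 7 ends and still admits a link onward, while the last one may
reach 8. Evenness of the remaining sum is what lets the last block be padded. -/
theorem exists_extendsMatching_of_isChain : ∀ (l : List I) (u : I) {M : SimpleGraph V},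
    (∀ v a b, M.Adj v a → M.Adj v b → a = b) → (u :: l).Nodup → (u :: l).IsChain O.Adj →
    endCount e M u ≤ 8 → (l ≠ [] → endCount e M u ≤ 7) →
    (∀ v ∈ l.dropLast, endCount e M v ≤ 5) → (∀ v ∈ l, endCount e M v ≤ 7) →
    Even ((u :: l).map (endCount e M)).sum →
    ∃ M', ExtendsMatching e O M M' ∧ (∀ v ∈ u :: l, endCount e M' v = 8) ∧
      (∀ v ∉ u :: l, endCount e M' v = endCount e M v) ∧
      (u :: l).IsChain (fun u v => ∃ a b, M'.Adj a b ∧ (e a).1 = u ∧ (e b).1 = v) := by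
  intro l
  induction l with
  | nil =>
    intro u M hM _ _ h8 _ _ _ hev
    obtain ⟨k, hk⟩ : Even (endCount e M u) := by simpa using hev
    obtain ⟨M', h1, h2, h3⟩ := exists_pad (e := e) (O := O) (u := u) (4 - k) hM (by omega)
    exact ⟨M', h1, by simpa using h2, fun v hv => h3 v (by simpa using hv), by simp⟩
  | cons v l ih =>
    intro u M hM hnd hch _ h7 h5 h7' hev
    replace h7 := h7 (by simp)
    have hv7 := h7' v (by simp)
    rw [List.isChain_cons_cons] at hch
    have huv := hch.1.ne
    have hul : u ∉ v :: l := (List.nodup_cons.1 hnd).1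
    have hv5 : l ≠ [] → endCount e M v ≤ 5 := fun h => h5 v (by
      rw [List.dropLast_cons_of_ne_nil h]; simp)
    have hev' : Even (endCount e M u + (endCount e M v + (l.map (endCount e M)).sum)) := by
      simpa using hev
    obtain ⟨M₁, h1, hlink, hu, hv, hw, hev1⟩ : ∃ M₁, ExtendsMatching e O M M₁ ∧
        (∃ a b, M₁.Adj a b ∧ (e a).1 = u ∧ (e b).1 = v) ∧
        (∃ k, endCount e M₁ u + 2 * k = 8) ∧
        (endCount e M₁ v ≤ 8 ∧ (l ≠ [] → endCount e M₁ v ≤ 7)) ∧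
        (∀ w, w ≠ u → w ≠ v → endCount e M₁ w = endCount e M w) ∧
        Even (endCount e M₁ v + (l.map (endCount e M)).sum) := by
      obtain ⟨M₁, h1, hlink, hu, hv, hw⟩ := exists_link (e := e) (O := O) hM hch.1 (by omega)
      -- One link makes an odd block even. An even block, having at most 6 ends, gets two; the
      -- second fits because 7 + 8 = 15. If `v` is the last block, its count is then also even, so
      -- at most 6 before and 8 after.
      rcases Nat.even_or_odd (endCount e M u) with hpar | hpar
      · obtain ⟨k, hk⟩ := hpar
        obtain ⟨M₂, h2, hlink', hu', hv', hw'⟩ := exists_link (e := e) (O := O) h1.matching hch.1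
          (by omega)
        refine ⟨M₂, h1.trans h2, hlink', ⟨3 - k, by omega⟩, ⟨?_, fun h => ?_⟩,
          fun w h h' => (hw' w h h').trans (hw w h h'), ?_⟩
        · rcases eq_or_ne l [] with rfl | h
          · simp only [List.map_nil, List.sum_nil, Nat.even_iff] at hev'
            omega
          · have := hv5 h
            omega
        · have := hv5 h
          omega
        · rw [Nat.even_iff] at hev' ⊢
          omega
      · obtain ⟨k, hk⟩ := hpar
        refine ⟨M₁, h1, hlink, ⟨3 - k, by omega⟩, ⟨by omega, fun h => ?_⟩, hw, ?_⟩
        · have := hv5 h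
          omega
        · rw [Nat.even_iff] at hev' ⊢
          omega
    obtain ⟨k, hk⟩ := hu
    obtain ⟨M₂, h2, hu2, hw2⟩ := exists_pad (e := e) (O := O) k h1.matching hk
    have hvl : v ∉ l := (List.nodup_cons.1 (List.nodup_cons.1 hnd).2).1
    have hcount : ∀ w ∈ l, endCount e M₂ w = endCount e M w := by
      intro w hwl
      have h3 : w ≠ u := fun h => hul (by simp [← h, hwl])
      rw [hw2 w h3, hw w h3 (fun h => hvl (h ▸ hwl))]
    have hv2 : endCount e M₂ v = endCount e M₁ v := hw2 v huv.symm
    obtain ⟨M₃, h3, h4, h5', h6⟩ := ih v h2.matching (List.nodup_cons.1 hnd).2 hch.2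
      (hv2 ▸ hv.1) (fun h => hv2 ▸ hv.2 h)
      (fun w hwl => by
        have hmem := List.mem_of_mem_dropLast hwl
        rw [hcount w hmem]
        refine h5 w ?_
        rw [List.dropLast_cons_of_ne_nil (List.ne_nil_of_mem hmem)]
        exact List.mem_cons_of_mem _ hwl)
      (fun w hwl => by rw [hcount w hwl]; exact h7' w (by simp [hwl]))
      (by
        rw [List.map_cons, List.sum_cons, hv2, List.map_congr_left hcount]
        exact hev1)
    refine ⟨M₃, (h1.trans h2).trans h3, fun w hwl => ?_, fun w hwl => ?_, ?_⟩
    · rcases List.mem_cons.1 hwl with rfl | hwl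
      · rw [h5' w hul, hu2]
      · exact h4 w hwl
    · simp only [List.mem_cons, not_or] at hwl
      rw [h5' w (by simp [hwl]), hw2 w hwl.1, hw w hwl.1 hwl.2.1]
    · rw [List.isChain_cons_cons]
      obtain ⟨a, b, hab, ha, hb⟩ := hlink
      exact ⟨⟨a, b, h3.le (h2.le hab), ha, hb⟩, h6⟩

theorem eqvGen_of_isChain {α : Type*} {r : α → α → Prop} : ∀ {l : List α}, l.IsChain r →
    ∀ x ∈ l, ∀ y ∈ l, Relation.EqvGen r x y := by
  intro l
  induction l with
  | nil => simp
  | cons a l ih =>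
    intro h
    have ha : ∀ y ∈ l, Relation.EqvGen r a y := by
      intro y hy
      cases l with
      | nil => simp at hy
      | cons b l =>
        rw [List.isChain_cons_cons] at h
        exact .trans _ _ _ (.rel _ _ h.1) (ih h.2 b (by simp) y hy)
    intro x hx y hy
    have ih' := ih h.tail
    rcases List.mem_cons.1 hx with h1 | h1 <;> rcases List.mem_cons.1 hy with h2 | h2
    · rw [h1, h2]
      exact .refl _
    · exact h1 ▸ ha y h2
    · exact h2 ▸ .symm _ _ (ha x h1)
    · exact ih' x h1 y h2

/-- The sum counts all ends of a matching, which come in pairs. -/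
theorem even_sum_endCount [Finite V] {M : SimpleGraph V}
    (hM : ∀ v a b, M.Adj v a → M.Adj v b → a = b) {l : List I} (hl : l.Nodup)
    (hl' : ∀ u, u ∈ l) : Even (l.map (endCount e M)).sum := by
  classical
  have := Fintype.ofFinite V
  have h := even_ncard_odd_degree M Set.univ (fun _ _ _ _ => trivial)
  have hs : {v | v ∈ Set.univ ∧ Odd (M.neighborSet v).ncard} = M.support := by
    ext v
    refine ⟨fun h => ?_, fun h => ⟨trivial, ?_⟩⟩
    · rw [mem_support_iff_ncard]
      exact h.2.pos
    · rw [ncard_neighborSet_of_matching hM h]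
      exact odd_one
  rw [hs, Set.ncard_eq_toFinset_card', Finset.card_eq_sum_card_fiberwise (f := fun v => (e v).1)
    (t := l.toFinset) (fun _ _ => Finset.mem_coe.2 (List.mem_toFinset.2 (hl' _))),
    List.sum_toFinset _ hl] at h
  rwa [List.map_congr_left fun u _ => ?_]
  rw [endCount, ← Set.ncard_coe_finset,
    ← Set.ncard_image_of_injective (f := fun x => e.symm (u, x)) _ (fun y z h => by simpa using h)]
  congr 1
  ext v
  simp only [Finset.coe_filter, Set.mem_toFinset, Set.mem_ofPred_eq, Set.mem_image, blockTrace]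
  constructor
  · rintro ⟨x, hx, rfl⟩
    exact ⟨hx, by simp⟩
  · rintro ⟨hv, rfl⟩
    exact ⟨(e v).2, by simpa using hv, by simp⟩

/-- A matching with at most seven ends in every block, and at most five except in the first and
last block of a Hamiltonian path of `O`, extends to a single long cycle. -/
theorem exists_isCycles_of_isChain [Finite V] {M : SimpleGraph V}
    (hM : ∀ v a b, M.Adj v a → M.Adj v b → a = b) {u : I} {l : List I} (hnd : (u :: l).Nodup)
    (hmem : ∀ v, v ∈ u :: l) (hch : (u :: l).IsChain O.Adj) (h7 : ∀ v, endCount e M v ≤ 7)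
    (h5 : ∀ v ∈ l.dropLast, endCount e M v ≤ 5) :
    ∃ S : SimpleGraph V,
      (∀ v w, S.Adj v w → ((e v).1 = (e w).1 ∧ fourCube.Adj (e v).2 (e w).2 ∨
        O.Adj (e v).1 (e w).1 ∧ (e v).2 = (e w).2)) ∧
      (M ⊔ S).IsCycles ∧
      (∀ v ∈ (M ⊔ S).support, ∀ w ∈ (M ⊔ S).support, (M ⊔ S).Reachable v w) ∧
      12 * Nat.card I ≤ (M ⊔ S).support.ncard := by
  have : Finite I := Finite.of_surjective (fun v => (e v).1)
    fun u => ⟨e.symm (u, 0), by simp⟩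
  obtain ⟨M', h1, h2, -, h3⟩ := exists_extendsMatching_of_isChain (O := O) l u hM hnd hch
    (by have := h7 u; omega) (fun _ => h7 u) h5 (fun v _ => h7 v)
    (even_sum_endCount hM hnd hmem)
  obtain ⟨S, h4, h5, h6, h7⟩ := exists_isCycles_of_eight (e := e) h1.matching
    (fun v => h2 v (hmem v)) (fun v w => eqvGen_of_isChain h3 v (hmem v) w (hmem w))
  have heq : M ⊔ (M' \ M ⊔ S) = M' ⊔ S := by
    rw [← sup_assoc, sup_sdiff_cancel_right h1.le]
  -- The edges of `M` are removed from `M'`, as they need not be cube edges.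
  refine ⟨M' \ M ⊔ S, ?_, ?_⟩
  · rintro v w (h | h)
    · rw [SimpleGraph.sdiff_adj] at h
      exact (h1.new v w h.1).resolve_left h.2
    · exact Or.inl (h4 v w h)
  · rw [heq]
    exact ⟨h5, h6, h7⟩

end Padding

/-! ### Hamiltonian paths of the hypercube -/

section GrayCode

variable {ι : Type*} [DecidableEq ι]

def flipBit (i : ι) (u : ι → Bool) : ι → Bool := Function.update u i (!u i)

theorem flipBit_flipBit (i : ι) (u : ι → Bool) : flipBit i (flipBit i u) = u := by
  simp [flipBit]

theorem flipBit_injective (i : ι) : Function.Injective (flipBit i) :=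
  Function.LeftInverse.injective (flipBit_flipBit i)

theorem hypercube_adj_flipBit (i : ι) (u : ι → Bool) : (hypercube ι).Adj u (flipBit i u) := by
  refine ⟨i, by simp [flipBit], fun j hj => ?_⟩
  by_contra h
  exact hj (by simp [flipBit, h])

theorem hypercube_adj_iff {u v : ι → Bool} :
    (hypercube ι).Adj u v ↔ ∃ i, v = flipBit i u := by
  refine ⟨fun ⟨i, hi, h⟩ => ⟨i, ?_⟩, by rintro ⟨i, rfl⟩; exact hypercube_adj_flipBit i u⟩
  ext j
  by_cases hj : j = i
  · subst hj
    have : v j = !u j := by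
      revert hi
      cases u j <;> cases v j <;> simp
    simp [flipBit, this]
  · have : u j = v j := not_not.1 fun h' => hj (h j h')
    simp [flipBit, hj, this]

theorem hypercube_adj_flipBit_flipBit {u v : ι → Bool} (i : ι) (h : (hypercube ι).Adj u v) :
    (hypercube ι).Adj (flipBit i u) (flipBit i v) := by
  obtain ⟨j, rfl⟩ := hypercube_adj_iff.1 h
  refine hypercube_adj_iff.2 ⟨j, ?_⟩
  by_cases hij : i = j
  · rw [hij]
  · ext k
    by_cases hki : k = i
    · subst hki
      simp [flipBit, hij]
    · by_cases hkj : k = j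
      · subst hkj
        simp [flipBit, hki]
      · simp [flipBit, hki, hkj]

/-- The reflected Gray code: traverse the half with coordinate `i` unchanged from `u` to `flipBit j
u`, cross in direction `i`, and return along the mirror image. The return ends at `flipBit i u`. -/
theorem exists_isChain_subcube (s : Finset ι) : ∀ i ∈ s, ∀ u : ι → Bool,
    ∃ l : List (ι → Bool), l.Nodup ∧ (∀ w, w ∈ l ↔ ∀ j ∉ s, w j = u j) ∧
      l.IsChain (hypercube ι).Adj ∧ l.head? = some u ∧ l.getLast? = some (flipBit i u) := by
  induction s using Finset.strongInduction with
  | H s ih =>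
    intro i hi u
    by_cases hs : ∃ j ∈ s, j ≠ i
    · obtain ⟨j, hj, hji⟩ := hs
      obtain ⟨l, h1, h2, h3, h4, h5⟩ := ih (s.erase i) (Finset.erase_ssubset hi) j
        (Finset.mem_erase.2 ⟨hji, hj⟩) u
      refine ⟨l ++ (l.map (flipBit i)).reverse, ?_, fun w => ?_, ?_, ?_, ?_⟩
      · refine List.nodup_append.2 ⟨h1, List.nodup_reverse.2
          (h1.map (flipBit_injective i)), fun a ha b hb hab => ?_⟩
        rw [List.mem_reverse, List.mem_map] at hb
        obtain ⟨c, hc, rfl⟩ := hb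
        have ha' := (h2 a).1 ha i (Finset.notMem_erase i s)
        have hc' := (h2 c).1 hc i (Finset.notMem_erase i s)
        rw [hab, ← hc'] at ha'
        simp [flipBit] at ha'
      · rw [List.mem_append, List.mem_reverse, List.mem_map]
        constructor
        · rintro (h | ⟨c, hc, rfl⟩) k hk
          · exact (h2 w).1 h k (fun h => hk (Finset.mem_of_mem_erase h))
          · have hki : k ≠ i := fun h => hk (h ▸ hi)
            simpa [flipBit, hki] using
              (h2 c).1 hc k (fun h => hk (Finset.mem_of_mem_erase h))
        · intro h
          by_cases hwi : w i = u i
          · refine Or.inl ((h2 w).2 fun k hk => ?_)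
            by_cases hki : k = i
            · rw [hki, hwi]
            · exact h k fun h => hk (Finset.mem_erase.2 ⟨hki, h⟩)
          · refine Or.inr ⟨flipBit i w, (h2 _).2 fun k hk => ?_, flipBit_flipBit i w⟩
            by_cases hki : k = i
            · subst hki
              revert hwi
              simp only [flipBit, Function.update_self]
              cases u k <;> cases w k <;> simp
            · simpa [flipBit, hki] using h k fun h => hk (Finset.mem_erase.2 ⟨hki, h⟩)
      · refine List.IsChain.append h3 ?_ ?_
        · rw [List.isChain_reverse, List.isChain_map]
          exact h3.imp fun a b hab => (hypercube_adj_flipBit_flipBit i hab).symm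
        · intro x hx y hy
          rw [h5, Option.mem_some_iff] at hx
          rw [List.head?_reverse, List.getLast?_map, h5, Option.map_some,
            Option.mem_some_iff] at hy
          rw [← hx, ← hy]
          exact hypercube_adj_flipBit i _
      · rw [List.head?_append, h4]
        rfl
      · rw [List.getLast?_append, List.getLast?_reverse, List.head?_map, h4]
        rfl
    · push Not at hs
      refine ⟨[u, flipBit i u], ?_, fun w => ?_, ?_, rfl, rfl⟩
      · simpa using (hypercube_adj_flipBit i u).ne
      · simp only [List.mem_cons, List.not_mem_nil, or_false]
        constructor
        · rintro (rfl | rfl) j hj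
          · rfl
          · have : j ≠ i := fun h => hj (h ▸ hi)
            simp [flipBit, this]
        · intro h
          have h' : ∀ j ≠ i, w j = u j := fun j hj => h j fun h => hj (hs j h)
          by_cases hwi : w i = u i
          · left
            ext j
            by_cases hj : j = i
            · rw [hj, hwi]
            · rw [h' j hj]
          · right
            ext j
            by_cases hj : j = i
            · subst hj
              revert hwi
              simp only [flipBit, Function.update_self]
              cases u j <;> cases w j <;> simp
            · simp [flipBit, hj, h' j hj]
      · simpa using hypercube_adj_flipBit i u

/-- Two adjacent vertices of a hypercube are the ends of a Hamiltonian path. -/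
theorem exists_hamiltonian_isChain [Fintype ι] {u v : ι → Bool} (h : (hypercube ι).Adj u v) :
    ∃ l : List (ι → Bool), (u :: l).Nodup ∧ (∀ w, w ∈ u :: l) ∧
      (u :: l).IsChain (hypercube ι).Adj ∧ ∀ w ∈ l.dropLast, w ≠ u ∧ w ≠ v := by
  obtain ⟨i, rfl⟩ := hypercube_adj_iff.1 h
  obtain ⟨l, h1, h2, h3, h4, h5⟩ := exists_isChain_subcube Finset.univ i (Finset.mem_univ i) u
  obtain ⟨l, rfl⟩ := List.head?_eq_some_iff.1 h4
  refine ⟨l, h1, fun w => (h2 w).2 (by simp), h3, fun w hw => ⟨?_, ?_⟩⟩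
  · rintro rfl
    exact (List.nodup_cons.1 h1).1 (List.mem_of_mem_dropLast hw)
  · rintro rfl
    have hl : l ≠ [] := by rintro rfl; simp at hw
    rw [List.getLast?_cons, List.getLast?_eq_some_getLast hl, Option.getD_some,
      Option.some_inj] at h5
    have h6 := (List.nodup_cons.1 h1).2
    rw [← List.dropLast_append_getLast hl, h5, List.nodup_append] at h6
    exact h6.2.2 _ hw _ (by simp) rfl

/-- If at most two vertices are special and any two of them are adjacent, then some Hamiltonian
path has no special vertices except at its ends. -/
theorem exists_hamiltonian_isChain_special [Fintype ι] (X : Set (ι → Bool)) (h2 : X.ncard ≤ 2)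
    (hX : ∀ u ∈ X, ∀ v ∈ X, u ≠ v → (hypercube ι).Adj u v) :
    ∃ (u : ι → Bool) (l : List (ι → Bool)), (u :: l).Nodup ∧ (∀ w, w ∈ u :: l) ∧
      (u :: l).IsChain (hypercube ι).Adj ∧ ∀ w ∈ l.dropLast, w ∉ X := by
  -- Without coordinates there is one block and no pair of adjacent vertices to choose.
  rcases isEmpty_or_nonempty ι with hι | ⟨⟨i⟩⟩
  · exact ⟨fun _ => false, [], by simp, fun w => by simp [Subsingleton.elim w fun _ => false],
      by simp, by simp⟩
  · suffices h : ∃ u v, (hypercube ι).Adj u v ∧ ∀ x ∈ X, x = u ∨ x = v by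
      obtain ⟨u, v, huv, h⟩ := h
      obtain ⟨l, h1, h2, h3, h4⟩ := exists_hamiltonian_isChain huv
      refine ⟨u, l, h1, h2, h3, fun w hw hwX => ?_⟩
      exact (h w hwX).elim (h4 w hw).1 (h4 w hw).2
    by_cases hs : ∃ a ∈ X, ∃ b ∈ X, a ≠ b
    · obtain ⟨a, ha, b, hb, hab⟩ := hs
      refine ⟨a, b, hX a ha b hb hab, fun x hx => ?_⟩
      have : ({a, b} : Set (ι → Bool)) = X := Set.eq_of_subset_of_ncard_le
        (Set.insert_subset ha (Set.singleton_subset_iff.2 hb))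
        (by rw [Set.ncard_pair hab]; exact h2) (Set.toFinite _)
      rw [← this] at hx
      exact hx
    · push Not at hs
      rcases X.eq_empty_or_nonempty with rfl | ⟨a, ha⟩
      · exact ⟨fun _ => false, _, hypercube_adj_flipBit i _, by simp⟩
      · exact ⟨a, _, hypercube_adj_flipBit i a, fun x hx => Or.inl (hs x hx a ha)⟩

end GrayCode

/-! ### The hypercube as a product, and the theorem -/

/-- A connected union of cycles is the edge set of a cycle. -/
theorem exists_isCycle_of_isCycles {V : Type*} [Finite V] {H : SimpleGraph V} (hH : H.IsCycles)
    (hc : ∀ v ∈ H.support, ∀ w ∈ H.support, H.Reachable v w) (hne : H.support.Nonempty) :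
    ∃ (x : V) (C : (⊤ : SimpleGraph V).Walk x x), C.IsCycle ∧ C.edgeSet = H.edgeSet ∧
      H.support.ncard ≤ C.length := by
  classical
  have := Fintype.ofFinite V
  obtain ⟨x, hx⟩ := hne
  obtain ⟨p, hp, hverts⟩ := hH.exists_cycle_toSubgraph_verts_eq_connectedComponentSupp
    (c := H.connectedComponentMk x) (v := x) rfl hx
  have hmem : ∀ v ∈ H.support, v ∈ p.toSubgraph.verts := by
    intro v hv
    rw [hverts]
    exact SimpleGraph.ConnectedComponent.sound (hc v hv x hx)
  refine ⟨x, p.mapLe le_top, (SimpleGraph.Walk.isCycle_mapLe le_top).2 hp, ?_, ?_⟩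
  · ext s
    induction s using Sym2.ind with
    | h v w =>
      rw [SimpleGraph.mem_edgeSet, SimpleGraph.Walk.mem_edgeSet, SimpleGraph.Walk.edges_mapLe_eq_edges,
        ← SimpleGraph.Walk.mem_edges_toSubgraph, SimpleGraph.Subgraph.mem_edgeSet]
      refine ⟨fun h => h.adj_sub, fun h => ?_⟩
      exact (hp.adj_toSubgraph_iff_of_isCycles hH (hmem v ⟨w, h⟩) w).2 h
  -- The tail of the vertex list drops one of the two occurrences of the base point, so its length
  -- is that of the cycle.
  · have hsub : H.support ⊆ (p.support.tail.toFinset : Set V) := by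
      intro v hv
      have h1 := hmem v hv
      rw [SimpleGraph.Walk.mem_verts_toSubgraph] at h1
      rw [List.coe_toFinset]
      rcases (SimpleGraph.Walk.mem_support_iff p).1 h1 with rfl | h
      · exact SimpleGraph.Walk.end_mem_tail_support hp.not_nil
      · exact h
    refine (Set.ncard_le_ncard hsub (Set.toFinite _)).trans ?_
    rw [Set.ncard_coe_finset]
    refine (List.toFinset_card_le _).trans ?_
    simp

def bitsOf (x : Fin 16) (i : Fin 4) : Bool := x.val.testBit i

theorem bitsOf_bijective : Function.Bijective bitsOf := by
  refine (Fintype.bijective_iff_injective_and_card _).2 ⟨?_, by simp⟩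
  have : ∀ x y : Fin 16, (∀ i : Fin 4, x.val.testBit i = y.val.testBit i) → x = y := by
    decide +kernel
  exact fun x y h => this x y (congrFun h)

theorem bitsOf_of_adj : ∀ x y : Fin 16, isUnitBit (x.val ^^^ y.val) = true →
    ∃ i : Fin 4, x.val.testBit i ≠ y.val.testBit i ∧
      ∀ j : Fin 4, x.val.testBit j ≠ y.val.testBit j → j = i := by
  decide +kernel

section Product

variable {n : ℕ} {D : Finset (Fin n)} (d : {i // i ∈ D} ≃ Fin 4)

/-- A string consists of its outer part and of its four coordinates in `D`. -/
noncomputable def stringEquiv : (Fin n → Bool) ≃ OuterString D × Fin 16 :=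
  ((Equiv.piEquivPiSubtypeProd (fun i => i ∈ D) fun _ => Bool).trans (Equiv.prodComm _ _)).trans
    ((Equiv.refl _).prodCongr
      ((d.arrowCongr (Equiv.refl Bool)).trans (Equiv.ofBijective _ bitsOf_bijective).symm))

theorem stringEquiv_fst (v : Fin n → Bool) : (stringEquiv d v).1 = fun i : {i // i ∉ D} => v i := rfl

theorem testBit_stringEquiv_snd (v : Fin n → Bool) (k : Fin 4) :
    (stringEquiv d v).2.val.testBit k = v (d.symm k) := by
  change bitsOf ((Equiv.ofBijective _ bitsOf_bijective).symm _) k = _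
  rw [← Equiv.ofBijective_apply bitsOf bitsOf_bijective, Equiv.apply_symm_apply]
  rfl

variable {d}

theorem hypercube_adj_of_fourCube_adj {v w : Fin n → Bool}
    (h1 : (stringEquiv d v).1 = (stringEquiv d w).1)
    (h2 : fourCube.Adj (stringEquiv d v).2 (stringEquiv d w).2) :
    (hypercube (Fin n)).Adj v w := by
  obtain ⟨k, hk, hk'⟩ := bitsOf_of_adj _ _ h2
  simp only [testBit_stringEquiv_snd] at hk hk'
  refine ⟨d.symm k, hk, fun i hi => ?_⟩
  by_cases hD : i ∈ D
  · have := hk' (d ⟨i, hD⟩) (by simpa using hi)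
    rw [← this]
    simp
  · exact absurd (congrFun h1 ⟨i, hD⟩) hi

theorem hypercube_adj_of_outer_adj {v w : Fin n → Bool}
    (h1 : (hypercube _).Adj (stringEquiv d v).1 (stringEquiv d w).1)
    (h2 : (stringEquiv d v).2 = (stringEquiv d w).2) : (hypercube (Fin n)).Adj v w := by
  obtain ⟨k, hk, hk'⟩ := h1
  refine ⟨k, hk, fun i hi => ?_⟩
  by_cases hD : i ∈ D
  · refine absurd ?_ hi
    have h3 := testBit_stringEquiv_snd d v (d ⟨i, hD⟩)
    have h4 := testBit_stringEquiv_snd d w (d ⟨i, hD⟩)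
    rw [h2, h4] at h3
    simpa using h3.symm
  · exact congrArg Subtype.val (hk' ⟨i, hD⟩ hi)

theorem endCount_eq_matchedCount {M : (cubeComplete n).Subgraph} (hM : M.IsMatching)
    (u : OuterString D) : endCount (stringEquiv d) M.spanningCoe u = matchedCount M D u := by
  rw [endCount, matchedCount, ← hM.support_eq_verts,
    ← Set.ncard_image_of_injective (f := fun x => (stringEquiv d).symm (u, x)) _
      (fun y z h => by simpa using h)]
  congr 1
  ext v
  simp only [Set.mem_image, blockTrace, Set.mem_inter_iff, subcube, Set.mem_ofPred_eq]
  constructor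
  · rintro ⟨x, hx, rfl⟩
    refine ⟨hx, fun i => ?_⟩
    have := stringEquiv_fst d ((stringEquiv d).symm (u, x))
    rw [Equiv.apply_symm_apply] at this
    exact (congrFun this i).symm
  · rintro ⟨hv, hu⟩
    obtain rfl : (stringEquiv d v).1 = u := funext hu
    exact ⟨(stringEquiv d v).2, by rw [Prod.mk.eta, Equiv.symm_apply_apply]; exact hv, by simp⟩

end Product

theorem mainTheorem3 (n : ℕ) (hn : 4 ≤ n)
    (M : (cubeComplete n).Subgraph) (hM : M.IsMatching)
    (D : Finset (Fin n)) (hD : D.card = 4)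
    (h7 : ∀ u : OuterString D, matchedCount M D u ≤ 7)
    (htwo : {u : OuterString D | matchedCount M D u = 6 ∨ matchedCount M D u = 7}.ncard ≤ 2)
    (hadj : ∀ u v : OuterString D, u ≠ v →
      (matchedCount M D u = 6 ∨ matchedCount M D u = 7) →
      (matchedCount M D v = 6 ∨ matchedCount M D v = 7) →
      SubcubesAdjacent D u v) :
    ∃ S : Set (Sym2 (Fin n → Bool)), S ⊆ (hypercube (Fin n)).edgeSet ∧
      ∃ (x : Fin n → Bool) (C : (cubeComplete n).Walk x x),
        C.IsCycle ∧ C.edgeSet = M.edgeSet ∪ S ∧ (3 / 4 : ℝ) * 2 ^ n ≤ (C.length : ℝ) := by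
  have d : {i // i ∈ D} ≃ Fin 4 := D.equivFinOfCardEq hD
  obtain ⟨u, l, hnd, hmem, hch, hX⟩ := exists_hamiltonian_isChain_special _ htwo
    fun u hu v hv huv => hadj u v huv hu hv
  have hmatch : ∀ v a b, M.spanningCoe.Adj v a → M.spanningCoe.Adj v b → a = b := by
    intro v a b ha hb
    exact (hM (M.edge_vert ha)).unique ha hb
  obtain ⟨S, h1, h2, h3, h4⟩ := exists_isCycles_of_isChain (e := stringEquiv d) hmatch hnd hmem hch
    (fun v => by rw [endCount_eq_matchedCount hM]; exact h7 v)
    (fun v hv => by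
      rw [endCount_eq_matchedCount hM]
      have h5 := hX v hv
      have h6 := h7 v
      simp only [Set.mem_ofPred_eq] at h5
      omega)
  -- There are `2 ^ (n - 4)` blocks with at least 12 cycle vertices each; the factor 4 clears the
  -- denominator of 3/4.
  have hcard : 12 * Nat.card (OuterString D) * 4 = 3 * 2 ^ n := by
    have : Nat.card (OuterString D) = 2 ^ (n - 4) := by
      rw [Nat.card_eq_fintype_card, Fintype.card_fun, Fintype.card_bool,
        Fintype.card_subtype_compl]
      simp [hD]
    rw [this, ← Nat.sub_add_cancel hn, pow_add]
    simp
    ring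
  have hpos := Nat.card_pos (α := OuterString D)
  obtain ⟨x, C, hC, hC', hlen⟩ := exists_isCycle_of_isCycles h2 h3
    (by rw [← Set.ncard_pos]; omega)
  refine ⟨S.edgeSet, ?_, x, C, hC, ?_, ?_⟩
  · intro s
    induction s using Sym2.ind with
    | h v w =>
      intro h
      rcases h1 v w h with h | h
      · exact hypercube_adj_of_fourCube_adj h.1 h.2
      · exact hypercube_adj_of_outer_adj h.1 h.2
  · rw [hC', SimpleGraph.edgeSet_sup]
    congr 1
  · have h5 : 3 * 2 ^ n ≤ C.length * 4 := by omega
    have h6 : (3 * 2 ^ n : ℝ) ≤ C.length * 4 := by exact_mod_cast h5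
    linarith
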